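/- Let $(\Omega,\mu)$ be a measure space and let $T$ be a positive self-adjoint $C_0$-semigroup on the complex Hilbert space $L_2(\mu)$, with generator $A$. For real-valued $W\in L_\infty(\mu)$ let $T_W$ denote the $C_0$-semigroup generated by $A-W$. A measurable function $V\colon\Omega\to\mathbb{R}$ is called $T$-admissible if, for each of the two functions $U=V^+=\max(V,0)$ and $U=-V^-=\min(V,0)$, the strong limit of $T_{(U\wedge n)\vee(-n)}(t)$ as $n\to\infty$ exists for every $t\ge 0$ and these limits form a $C_0$-semigroup. For $T$-admissible $V$ define $T_V(t)$, $t\ge0$, as the strong limit of $T_{(V\wedge n)\vee(-n)}(t)$ as $n\to\infty$. Let $\gamma>0$ and let $f,g\in L_2(\mu)$, $f,g\ge 0$, be such that \[ \langle T(t)f,g\rangle\le e^{-\gamma/t}\,\|f\|_2\,\|g\|_2\qquad(t>0). \] Let $V\colon\Omega\to\mathbb{R}$ be $T$-admissible, and assume that $T_V$ is contractive, i.e. $\|T_V(t)\|\le 1$ for all $t\ge 0$. Then (the strong limits defining $T_V(t)$, $t\ge0$, exist and) \[ \langle T_V(t)f,g\rangle\le e^{-\gamma/t}\,\|f\|_2\,\|g\|_2\qquad(t>0).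 \] -/

import Mathlib

open MeasureTheory Filter Topology
open scoped NNReal ENNReal ComplexOrder

noncomputable section

/-- A `C₀`-semigroup on a complex normed space `E`, indexed by `[0, ∞)`. -/
structure C0Semigroup (E : Type*) [NormedAddCommGroup E] [NormedSpace ℂ E] where
  /-- The operators `T(t)`. -/
  op : ℝ≥0 → E →L[ℂ] E
  op_zero : op 0 = 1
  op_add : ∀ s t, op (s + t) = op s * op t
  continuous_op : ∀ f : E, Continuous fun t => op t f

namespace C0Semigroup

section Generator

variable {E : Type*} [NormedAddCommGroup E] [NormedSpace ℂ E] (T : C0Semigroup E)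

/-- The difference quotient `t⁻¹ (T(t) f - f)`. -/
def diffQuot (f : E) (t : ℝ≥0) : E := (((t : ℝ) : ℂ))⁻¹ • (T.op t f - f)

theorem tendsto_diffQuot_add {f f' g g' : E}
    (h : Tendsto (T.diffQuot f) (𝓝[>] 0) (𝓝 g)) (h' : Tendsto (T.diffQuot f') (𝓝[>] 0) (𝓝 g')) :
    Tendsto (T.diffQuot (f + f')) (𝓝[>] 0) (𝓝 (g + g')) := by
  refine (h.add h').congr fun t => ?_
  simp only [diffQuot, map_add, ← smul_add]
  congr 1
  abel

theorem tendsto_diffQuot_smul (c : ℂ) {f g : E} (h : Tendsto (T.diffQuot f) (𝓝[>] 0) (𝓝 g)) :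
    Tendsto (T.diffQuot (c • f)) (𝓝[>] 0) (𝓝 (c • g)) := by
  refine (h.const_smul c).congr fun t => ?_
  simp only [diffQuot, map_smul, ← smul_sub]
  rw [smul_comm]

/-- The domain of the generator: all `f` for which `t⁻¹ (T(t) f - f)` converges as `t → 0+`. -/
def generatorDomain : Submodule ℂ E where
  carrier := {f | ∃ g, Tendsto (T.diffQuot f) (𝓝[>] 0) (𝓝 g)}
  zero_mem' := ⟨0, by
    have : T.diffQuot 0 = fun _ => 0 := by
      funext t
      simp [diffQuot]
    rw [this]
    exact tendsto_const_nhds⟩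
  add_mem' := by
    rintro f f' ⟨g, h⟩ ⟨g', h'⟩
    exact ⟨g + g', T.tendsto_diffQuot_add h h'⟩
  smul_mem' := by
    rintro c f ⟨g, h⟩
    exact ⟨c • g, T.tendsto_diffQuot_smul c h⟩

theorem tendsto_choose (f : T.generatorDomain) :
    Tendsto (T.diffQuot f) (𝓝[>] 0) (𝓝 f.2.choose) := f.2.choose_spec

/-- The generator `A` of the semigroup, as an unbounded operator:
`A f = lim_{t → 0+} t⁻¹ (T(t) f - f)`, with maximal domain. -/
def generator : E →ₗ.[ℂ] E where
  domain := T.generatorDomain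
  toFun :=
    { toFun := fun f => f.2.choose
      map_add' := fun f f' => tendsto_nhds_unique (T.tendsto_choose (f + f'))
        (T.tendsto_diffQuot_add (T.tendsto_choose f) (T.tendsto_choose f'))
      map_smul' := fun c f => tendsto_nhds_unique (T.tendsto_choose (c • f))
        (T.tendsto_diffQuot_smul c (T.tendsto_choose f)) }

/-- A value of the generator is the limit of the difference quotients. -/
theorem tendsto_generator (f : T.generator.domain) :
    Tendsto (T.diffQuot f) (𝓝[>] 0) (𝓝 (T.generator f)) := f.2.choose_spec

end Generator

variable {Ω : Type*} [MeasurableSpace Ω] {μ : Measure Ω}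

/-- `T` is positive: each `T(t)` maps nonnegative functions to nonnegative functions. -/
def IsPositive (T : C0Semigroup (Lp ℂ 2 μ)) : Prop :=
  ∀ t, ∀ f : Lp ℂ 2 μ, 0 ≤ f → 0 ≤ T.op t f

/-- `T` is self-adjoint: each `T(t)` is a self-adjoint operator. -/
def IsSelfAdjoint (T : C0Semigroup (Lp ℂ 2 μ)) : Prop :=
  ∀ t, _root_.IsSelfAdjoint (T.op t)

/-- Multiplication by a real function `W ∈ L_∞(μ)`, as an operator on `L_2(μ)`. -/
def mulOp (W : Lp ℝ ∞ μ) : Lp ℂ 2 μ →ₗ[ℂ] Lp ℂ 2 μ where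
  toFun f := W • f
  map_add' f g := Lp.add_smul W f g
  map_smul' c f := by
    apply Lp.ext
    rw [RingHom.id_apply]
    filter_upwards [Lp.coeFn_lpSMul (r := 2) W (c • f), Lp.coeFn_smul c f,
      Lp.coeFn_smul c (W • f : Lp ℂ 2 μ), Lp.coeFn_lpSMul (r := 2) W f] with x h1 h2 h3 h4
    rw [h1, h3, Pi.smul_apply', Pi.smul_apply, h2, h4, Pi.smul_apply', Pi.smul_apply, smul_comm]

open Classical in
/-- For `W ∈ L_∞(μ)`, the semigroup `T_W` generated by `A - W`, where `A` is the generator of `T`.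
(It exists by the bounded perturbation theorem, and is unique since a `C₀`-semigroup
is determined by its generator; so the default value is never taken.) -/
def boundedPerturb (T : C0Semigroup (Lp ℂ 2 μ)) (W : Lp ℝ ∞ μ) : C0Semigroup (Lp ℂ 2 μ) :=
  if h : ∃ S : C0Semigroup (Lp ℂ 2 μ), S.generator = T.generator - (mulOp W).toPMap ⊤
  then h.choose else T

variable (μ) in
/-- The bounded potential `(V ∧ n) ∨ (-n) ∈ L_∞(μ)`. It is `V ∧ n` if `V ≥ 0`, and
`V ∨ (-n)` if `V ≤ 0`. -/
def truncation {V : Ω → ℝ} (hV : Measurable V) (n : ℕ) : Lp ℝ ∞ μ :=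
  MemLp.toLp (fun x => max (min (V x) n) (-n)) <|
    memLp_top_of_bound ((hV.min measurable_const).max measurable_const).aestronglyMeasurable n
      (.of_forall fun x => by
        rw [Real.norm_eq_abs, abs_le]
        have hn : (0 : ℝ) ≤ n := n.cast_nonneg
        exact ⟨le_max_right _ _, max_le (min_le_right _ _) (by linarith)⟩)

/-- `L` is the strong limit of the operators `T_{(V ∧ n) ∨ (-n)}(t)` as `n → ∞`. -/
def IsPerturbLimit (T : C0Semigroup (Lp ℂ 2 μ)) {V : Ω → ℝ} (hV : Measurable V) (t : ℝ≥0)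
    (L : Lp ℂ 2 μ →L[ℂ] Lp ℂ 2 μ) : Prop :=
  ∀ f, Tendsto (fun n => (T.boundedPerturb (truncation μ hV n)).op t f) atTop (𝓝 (L f))

/-- The operators `T_{(V ∧ n) ∨ (-n)}(t)` converge strongly for all `t ≥ 0`, and the limits
form a `C₀`-semigroup. -/
def HasPerturbSemigroup (T : C0Semigroup (Lp ℂ 2 μ)) {V : Ω → ℝ} (hV : Measurable V) : Prop :=
  ∃ S : C0Semigroup (Lp ℂ 2 μ), ∀ t, T.IsPerturbLimit hV t (S.op t)

/-- `V` is `T`-admissible: both `V⁺` and `-V⁻` are, where admissibility of a potential of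
constant sign means that the truncated semigroups converge strongly to a `C₀`-semigroup. -/
def IsAdmissible (T : C0Semigroup (Lp ℂ 2 μ)) {V : Ω → ℝ} (hV : Measurable V) : Prop :=
  T.HasPerturbSemigroup (V := fun x => max (V x) 0) (hV.max measurable_const) ∧
    T.HasPerturbSemigroup (V := fun x => min (V x) 0) (hV.min measurable_const)

open Classical in
/-- The perturbed operator `T_V(t)`: the strong limit of `T_{(V ∧ n) ∨ (-n)}(t)` as `n → ∞`
(and `0` if there is none). -/
def perturb (T : C0Semigroup (Lp ℂ 2 μ)) {V : Ω → ℝ} (hV : Measurable V) (t : ℝ≥0) :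
    Lp ℂ 2 μ →L[ℂ] Lp ℂ 2 μ :=
  if h : ∃ L, T.IsPerturbLimit hV t L then h.choose else 0

end C0Semigroup

end

open MeasureTheory Filter Topology
open scoped NNReal ENNReal ComplexOrder

noncomputable section

/-! Write `T_{V∨(-n)}` for the strong limit of `T_{(V∧m)∨(-n)}` as `m → ∞`. A potential bounded
below by `-n` gives `T_{V∨(-n)}(t) ≤ e^{nt} T(t)` on nonnegative functions, so the Davies–Gaffney
bound for `T` passes to `T_{V∨(-n)}` at the price of a factor `e^{nt}`. On the other hand
`T_{V∨(-n)} ≤ T_V` there, so contractivity of `T_V` makes the self-adjoint semigroup `T_{V∨(-n)}`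
contractive (`norm_le_one_of_nonneg`).

A contractive self-adjoint semigroup `P` extends to a holomorphic family `P(t)^z` of contractions on
`Re z > 0`. For `F(z) = ⟨P(t)^z f, g⟩` the function `F(1/w) e^{γw/t}` has exponential type and is
controlled on the imaginary axis by `‖f‖‖g‖`; the factor `e^{nt}` only affects its bound near `w =
0` on the real axis. Phragmén–Lindelöf then removes that factor (`norm_le_exp_neg_div`,
`norm_inner_le_of_exp`), and `n → ∞` gives the claim.

The limits exist by monotonicity in `m` and, in `n`, by comparison with `-V⁻`: Duhamel's formula
shows that lowering the potential has a larger effect when the potential is smaller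
(`boundedPerturb_sub_le_sub`). Thus the Cauchy property for `-V⁻` carries over uniformly in `m`
(`exists_isPerturbLimit`). -/

namespace C0Semigroup

/-! ### Growth, rescaling and Duhamel's formula for `C₀`-semigroups -/

section General

variable {E : Type*} [NormedAddCommGroup E] [NormedSpace ℂ E]

/-- Operator norms of a `C₀`-semigroup grow at most exponentially. -/
theorem exists_norm_op_le [CompleteSpace E] (T : C0Semigroup E) :
    ∃ M ω : ℝ, 1 ≤ M ∧ 0 ≤ ω ∧ ∀ t, ‖T.op t‖ ≤ M * Real.exp (ω * t) := by
  obtain ⟨C, hC⟩ := banach_steinhaus (g := fun t : Set.Icc (0 : ℝ≥0) 1 => T.op t) fun f => by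
    obtain ⟨C, hC⟩ := isCompact_Icc.exists_bound_of_continuousOn
      (T.continuous_op f).continuousOn (s := Set.Icc (0 : ℝ≥0) 1)
    exact ⟨C, fun t => hC t t.2⟩
  have hM : (1 : ℝ) ≤ max C 1 := le_max_right _ _
  have key : ∀ n : ℕ, ∀ t : ℝ≥0, t ≤ n + 1 → ‖T.op t‖ ≤ max C 1 ^ (n + 1) := by
    intro n
    induction n with
    | zero =>
      intro t ht
      rw [zero_add, pow_one]
      exact (hC ⟨t, zero_le, by simpa using ht⟩).trans (le_max_left _ _)
    | succ n ih =>
      intro t ht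
      rcases le_total t 1 with h | h
      · exact ((hC ⟨t, zero_le, h⟩).trans (le_max_left _ _)).trans
          (le_self_pow₀ hM (Nat.succ_ne_zero _))
      · have h1 : t = 1 + (t - 1) := (add_tsub_cancel_of_le h).symm
        rw [h1, T.op_add, pow_succ']
        refine (norm_mul_le _ _).trans (mul_le_mul ?_ (ih _ ?_) (norm_nonneg _) (by positivity))
        · exact (hC ⟨1, zero_le, le_rfl⟩).trans (le_max_left _ _)
        · rw [tsub_le_iff_right]
          exact_mod_cast ht
  refine ⟨max C 1, Real.log (max C 1), hM, Real.log_nonneg hM, fun t => ?_⟩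
  -- With `C = max C 1`, the bound `C ^ (⌊t⌋ + 1)` is at most `C * C ^ t`, hence `M = C` and `ω =
  -- log C`.
  refine (key ⌊t⌋₊ t (Nat.lt_floor_add_one t).le).trans ?_
  rw [pow_succ', Real.exp_mul, Real.exp_log (by positivity)]
  refine mul_le_mul_of_nonneg_left ?_ (by positivity)
  rw [← Real.rpow_natCast]
  exact Real.rpow_le_rpow_of_exponent_le hM (mod_cast Nat.floor_le (zero_le (a := t)))

theorem continuous_op_uncurry [CompleteSpace E] (T : C0Semigroup E) :
    Continuous fun p : ℝ≥0 × E => T.op p.1 p.2 := by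
  obtain ⟨M, ω, hM, hω, hb⟩ := T.exists_norm_op_le
  refine continuous_iff_continuousAt.2 fun ⟨t, f⟩ => ?_
  refine tendsto_iff_norm_sub_tendsto_zero.2 ?_
  have h1 : Tendsto (fun p : ℝ≥0 × E => M * Real.exp (ω * p.1) * ‖p.2 - f‖ +
      ‖T.op p.1 f - T.op t f‖) (𝓝 (t, f)) (𝓝 0) := by
    have : Continuous fun p : ℝ≥0 × E => M * Real.exp (ω * p.1) * ‖p.2 - f‖ +
      ‖T.op p.1 f - T.op t f‖ := by
      have := T.continuous_op f
      fun_prop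
    exact this.tendsto' _ _ (by simp)
  refine squeeze_zero (fun _ => norm_nonneg _) (fun p => ?_) h1
  calc ‖T.op p.1 p.2 - T.op t f‖ = ‖T.op p.1 (p.2 - f) + (T.op p.1 f - T.op t f)‖ := by
        rw [map_sub]; congr 1; abel
    _ ≤ _ := (norm_add_le _ _).trans (by
        gcongr
        exact (T.op p.1).le_of_opNorm_le (hb _) _)

@[fun_prop]
theorem _root_.Continuous.c0Semigroup_op [CompleteSpace E] (T : C0Semigroup E) {X : Type*}
    [TopologicalSpace X] {s : X → ℝ≥0} {u : X → E} (hs : Continuous s) (hu : Continuous u) :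
    Continuous fun x => T.op (s x) (u x) :=
  T.continuous_op_uncurry.comp (hs.prodMk hu)

theorem op_apply_add (T : C0Semigroup E) (s t : ℝ≥0) (f : E) :
    T.op (s + t) f = T.op s (T.op t f) := by
  rw [T.op_add]; rfl

theorem op_comm (T : C0Semigroup E) (s t : ℝ≥0) (f : E) :
    T.op s (T.op t f) = T.op t (T.op s f) := by
  rw [← op_apply_add, add_comm, op_apply_add]

/-- The semigroup `e^{ct} T(t)`. -/
def rescale (T : C0Semigroup E) (c : ℝ) : C0Semigroup E where
  op t := (Real.exp (c * t) : ℂ) • T.op t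
  op_zero := by simp [T.op_zero]
  op_add s t := by
    rw [T.op_add, smul_mul_smul_comm, ← Complex.ofReal_mul, ← Real.exp_add, NNReal.coe_add, mul_add]
  continuous_op f := by
    have := T.continuous_op f
    simp only [_root_.smul_apply]
    fun_prop

theorem rescale_op_apply (T : C0Semigroup E) (c : ℝ) (t : ℝ≥0) (f : E) :
    (T.rescale c).op t f = (Real.exp (c * t) : ℂ) • T.op t f := rfl

/-- The generator of `S` is the generator of `T` plus the bounded operator `B`, expressed through
the limits of the difference quotients. -/
def IsPerturb (T S : C0Semigroup E) (B : E →L[ℂ] E) : Prop :=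
  ∀ f g, Tendsto (T.diffQuot f) (𝓝[>] 0) (𝓝 g) ↔ Tendsto (S.diffQuot f) (𝓝[>] 0) (𝓝 (g + B f))

theorem IsPerturb.symm {T S : C0Semigroup E} {B : E →L[ℂ] E} (h : T.IsPerturb S B) :
    S.IsPerturb T (-B) := fun f g => by
  rw [h f (g + (-B) f)]
  simp

theorem IsPerturb.trans {T S R : C0Semigroup E} {B C : E →L[ℂ] E} (h : T.IsPerturb S B)
    (h' : S.IsPerturb R C) : T.IsPerturb R (B + C) := fun f g => by
  rw [h, h', _root_.add_apply, add_assoc]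

theorem tendsto_diffQuot_rescale (T : C0Semigroup E) (c : ℝ) {f g : E}
    (h : Tendsto (T.diffQuot f) (𝓝[>] 0) (𝓝 g)) :
    Tendsto ((T.rescale c).diffQuot f) (𝓝[>] 0) (𝓝 (g + (c : ℂ) • f)) := by
  have h1 : Tendsto (fun t : ℝ≥0 => (Real.exp (c * t) : ℂ)) (𝓝[>] 0) (𝓝 1) := by
    refine tendsto_nhdsWithin_of_tendsto_nhds ?_
    have : Continuous fun t : ℝ≥0 => (Real.exp (c * t) : ℂ) := by fun_prop
    exact this.tendsto' _ _ (by simp)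
  have h2 : Tendsto (fun t : ℝ≥0 => (((t : ℝ)⁻¹ * (Real.exp (c * t) - 1) : ℝ) : ℂ))
      (𝓝[>] 0) (𝓝 c) := by
    refine (Complex.continuous_ofReal.tendsto c).comp ?_
    have hd : HasDerivAt (fun t : ℝ => Real.exp (c * t)) c 0 := by
      have := ((hasDerivAt_id (0 : ℝ)).const_mul c).exp
      simpa using this
    have := hd.hasDerivWithinAt (s := Set.Ioi 0)
    rw [hasDerivWithinAt_iff_tendsto_slope' (by simp)] at this
    have hm : Tendsto (fun t : ℝ≥0 => (t : ℝ)) (𝓝[>] 0) (𝓝[>] 0) := by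
      refine tendsto_nhdsWithin_iff.2 ⟨tendsto_nhdsWithin_of_tendsto_nhds
        (NNReal.continuous_coe.tendsto' _ _ (by simp)), ?_⟩
      filter_upwards [self_mem_nhdsWithin] with t ht
      exact NNReal.coe_pos.2 ht
    refine (this.comp hm).congr fun t => ?_
    simp [slope_def_field, div_eq_inv_mul]
  have h3 := (h1.smul h).add (h2.smul_const f)
  rw [one_smul] at h3
  refine h3.congr fun t => ?_
  simp only [diffQuot, rescale_op_apply, smul_sub, smul_smul, Complex.ofReal_mul,
    Complex.ofReal_sub, Complex.ofReal_inv, mul_sub, sub_smul, mul_one]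
  rw [mul_comm (((t : ℝ) : ℂ))⁻¹]
  abel

theorem rescale_rescale (T : C0Semigroup E) (c : ℝ) : (T.rescale c).rescale (-c) = T := by
  have : ((T.rescale c).rescale (-c)).op = T.op := by
    funext t
    change (Real.exp (-c * t) : ℂ) • (Real.exp (c * t) : ℂ) • T.op t = _
    rw [smul_smul, ← Complex.ofReal_mul, ← Real.exp_add]
    simp
  cases T
  simp_all [rescale]

theorem isPerturb_rescale (T : C0Semigroup E) (c : ℝ) :
    T.IsPerturb (T.rescale c) ((c : ℂ) • 1) := fun f g => by
  refine ⟨fun h => T.tendsto_diffQuot_rescale c h, fun h => ?_⟩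
  have := (T.rescale c).tendsto_diffQuot_rescale (-c) h
  rw [rescale_rescale] at this
  simpa using this

theorem tendsto_diffQuot_op (T : C0Semigroup E) (s : ℝ≥0) {f g : E}
    (h : Tendsto (T.diffQuot f) (𝓝[>] 0) (𝓝 g)) :
    Tendsto (T.diffQuot (T.op s f)) (𝓝[>] 0) (𝓝 (T.op s g)) := by
  refine (((T.op s).continuous.tendsto g).comp h).congr fun t => ?_
  simp only [diffQuot, Function.comp_apply, map_smul, map_sub, T.op_comm s t]

theorem tendsto_toNNReal_sub_nhdsGT (r : ℝ) :
    Tendsto (fun x : ℝ => (x - r).toNNReal) (𝓝[>] r) (𝓝[>] 0) := by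
  refine tendsto_nhdsWithin_iff.2 ⟨tendsto_nhdsWithin_of_tendsto_nhds ?_, ?_⟩
  · have : Continuous fun x : ℝ => (x - r).toNNReal := by fun_prop
    exact this.tendsto' _ _ (by simp)
  · filter_upwards [self_mem_nhdsWithin] with x hx
    exact Real.toNNReal_pos.2 (sub_pos.2 hx)

section Complete

variable [CompleteSpace E]

theorem integral_op_sub (T : C0Semigroup E) (f : E) (r : ℝ≥0) {t : ℝ} (ht : 0 ≤ t) :
    T.op r (∫ s in (0 : ℝ)..t, T.op s.toNNReal f) - ∫ s in (0 : ℝ)..t, T.op s.toNNReal f =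
      (∫ s in t..(t + r), T.op s.toNNReal f) - ∫ s in (0 : ℝ)..r, T.op s.toNNReal f := by
  have hc : Continuous fun s : ℝ => T.op s.toNNReal f := by fun_prop
  have hi : ∀ a b : ℝ, IntervalIntegrable (fun s : ℝ => T.op s.toNNReal f) volume a b :=
    fun a b => hc.intervalIntegrable a b
  have h1 : T.op r (∫ s in (0 : ℝ)..t, T.op s.toNNReal f) =
      ∫ s in (r : ℝ)..(t + r), T.op s.toNNReal f := by
    rw [← ContinuousLinearMap.intervalIntegral_comp_comm _ (hi _ _)]
    rw [← zero_add (r : ℝ), ← add_assoc, add_zero t,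
      ← intervalIntegral.integral_comp_add_right (fun s : ℝ => T.op s.toNNReal f) (r : ℝ)]
    refine intervalIntegral.integral_congr fun s hs => ?_
    rw [Set.uIcc_of_le ht] at hs
    rw [Real.toNNReal_add hs.1 r.coe_nonneg, Real.toNNReal_coe, add_comm, op_apply_add]
  rw [h1, ← intervalIntegral.integral_add_adjacent_intervals (hi r t) (hi t (t + r)),
    ← intervalIntegral.integral_add_adjacent_intervals (hi 0 r) (hi r t)]
  abel

/-- The substitution `s = t x + a` turns the average into an integral over `[0, 1]` that is
continuous in `t`, also at `t = 0`. The integrand may depend on `t` so that convolutions `∫₀ᵗ T(t -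
s) ⋯` are covered. -/
theorem tendsto_inv_smul_integral {φ : ℝ → ℝ → E} (hφ : Continuous φ.uncurry) (a : ℝ) :
    Tendsto (fun t : ℝ => ((t : ℂ))⁻¹ • ∫ s in a..(a + t), φ t s) (𝓝[>] 0) (𝓝 (φ 0 a)) := by
  have hc : Continuous fun t : ℝ => ∫ x in (0 : ℝ)..1, φ t (t * x + a) := by
    refine intervalIntegral.continuous_parametric_intervalIntegral_of_continuous' ?_ _ _
    exact hφ.comp (f := fun p : ℝ × ℝ => (p.1, p.1 * p.2 + a)) (by fun_prop)
  have h0 := hc.tendsto' 0 (φ 0 a) (by simp)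
  refine (h0.mono_left nhdsWithin_le_nhds).congr' ?_
  filter_upwards [self_mem_nhdsWithin] with t ht
  rw [intervalIntegral.integral_comp_mul_add _ (ne_of_gt ht), ← Complex.ofReal_inv,
    Complex.coe_smul]
  simp [add_comm]

/-- The generator of a `C₀`-semigroup is densely defined. -/
theorem dense_generatorDomain (T : C0Semigroup E) : Dense (T.generatorDomain : Set E) := by
  intro f
  have hc : Continuous (Function.uncurry fun _ s : ℝ => T.op s.toNNReal f) := by
    simp only [Function.uncurry_def]; fun_prop
  have hlim : Tendsto (fun t : ℝ => ((t : ℂ))⁻¹ • ∫ s in (0 : ℝ)..(0 + t), T.op s.toNNReal f)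
      (𝓝[>] 0) (𝓝 f) := by
    have := tendsto_inv_smul_integral hc 0
    simpa [T.op_zero] using this
  refine mem_closure_of_tendsto hlim ?_
  filter_upwards [self_mem_nhdsWithin] with t ht
  -- The difference quotient of `∫₀ᵗ T(s) f ds` is an average over `[t, t + r]` minus one over `[0,
  -- r]`.
  refine T.generatorDomain.smul_mem _ ⟨T.op t.toNNReal f - f, ?_⟩
  have hm : Tendsto (fun t : ℝ≥0 => (t : ℝ)) (𝓝[>] 0) (𝓝[>] 0) := by
    refine tendsto_nhdsWithin_iff.2 ⟨tendsto_nhdsWithin_of_tendsto_nhds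
      (NNReal.continuous_coe.tendsto' _ _ (by simp)), ?_⟩
    filter_upwards [self_mem_nhdsWithin] with t ht
    exact NNReal.coe_pos.2 ht
  have h1 := ((tendsto_inv_smul_integral hc t).sub (tendsto_inv_smul_integral hc 0)).comp hm
  rw [Real.toNNReal_zero, T.op_zero] at h1
  refine h1.congr fun r => ?_
  simp only [Function.comp_apply, diffQuot, zero_add, ← smul_sub]
  rw [T.integral_op_sub f r (le_of_lt ht)]

/-- The path `s ↦ S(t - s) T(s) f` joins `S(t) f` to `T(t) f` and has right derivative `-S(t - s) B
T(s) f`, because the generators differ by `B`. -/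
theorem duhamel_of_mem {T S : C0Semigroup E} {B : E →L[ℂ] E} (h : T.IsPerturb S B) (t : ℝ≥0)
    {f g : E} (hf : Tendsto (T.diffQuot f) (𝓝[>] 0) (𝓝 g)) :
    S.op t f - T.op t f =
      ∫ s in (0 : ℝ)..t, S.op (t - s).toNNReal (B (T.op s.toNNReal f)) := by
  have hc : Continuous fun s : ℝ => S.op (t - s).toNNReal (T.op s.toNNReal f) := by fun_prop
  have hc' : Continuous fun s : ℝ => -S.op (t - s).toNNReal (B (T.op s.toNNReal f)) := by fun_prop
  have key := intervalIntegral.integral_eq_sub_of_hasDeriv_right_of_le (a := 0) (b := (t : ℝ))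
    t.2 hc.continuousOn (fun r hr => ?_) (hc'.intervalIntegrable 0 (t : ℝ))
  · rw [intervalIntegral.integral_neg] at key
    rw [← neg_inj, key]
    simp [T.op_zero, S.op_zero]
  · rw [hasDerivWithinAt_iff_tendsto_slope' (by simp)]
    have hx := T.tendsto_diffQuot_op r.toNNReal hf
    have hx' := (h _ _).1 hx
    have h1 : Tendsto (fun x : ℝ => (t - x).toNNReal) (𝓝[>] r) (𝓝 (t - r).toNNReal) := by
      refine tendsto_nhdsWithin_of_tendsto_nhds ?_
      have : Continuous fun x : ℝ => (t - x).toNNReal := by fun_prop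
      exact this.tendsto r
    have h2 := (S.continuous_op_uncurry.tendsto _).comp
      (h1.prodMk_nhds ((hx.sub hx').comp (tendsto_toNNReal_sub_nhdsGT r)))
    simp only [sub_add_cancel_left, map_neg] at h2
    -- By `S(t - r) = S(t - x) S(x - r)`, the slope from `r` to `x` is `S(t - x)` applied to the
    -- difference of the two difference quotients at `T(r) f`.
    refine h2.congr' ?_
    filter_upwards [Ioo_mem_nhdsGT hr.2] with x hx
    have e1 : (t - r).toNNReal = (t - x).toNNReal + (x - r).toNNReal := by
      rw [← Real.toNNReal_add (by linarith [hx.2]) (by linarith [hx.1])]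
      congr 1; ring
    have e2 : x.toNNReal = (x - r).toNNReal + r.toNNReal := by
      rw [← Real.toNNReal_add (by linarith [hx.1]) hr.1.le]
      congr 1; ring
    have e3 : (((x - r).toNNReal : ℝ) : ℂ)⁻¹ = (((x - r)⁻¹ : ℝ) : ℂ) := by
      rw [Real.coe_toNNReal _ (by linarith [hx.1]), Complex.ofReal_inv]
    simp only [Function.comp_apply, diffQuot, slope_def_module, e1, e2, op_apply_add, e3,
      ← smul_sub, Complex.coe_smul, sub_sub_sub_cancel_right]
    exact (S.op _).map_smul_of_tower _ _ |>.trans (by rw [map_sub])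

/-- Duhamel's formula for a bounded perturbation. -/
theorem duhamel {T S : C0Semigroup E} {B : E →L[ℂ] E} (h : T.IsPerturb S B) (t : ℝ≥0) (f : E) :
    S.op t f - T.op t f =
      ∫ s in (0 : ℝ)..t, S.op (t - s).toNNReal (B (T.op s.toNNReal f)) := by
  have hcl : IsClosed {f : E | S.op t f - T.op t f =
      ∫ s in (0 : ℝ)..t, S.op (t - s).toNNReal (B (T.op s.toNNReal f))} := by
    refine isClosed_eq (by fun_prop) ?_
    refine intervalIntegral.continuous_parametric_intervalIntegral_of_continuous' ?_ _ _
    simp only [Function.uncurry_def]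
    fun_prop
  exact hcl.closure_subset_iff.2 (fun f hf => duhamel_of_mem h t hf.choose_spec)
    (T.dense_generatorDomain f)

/-- A semigroup is determined by its generator. This transfers properties of a constructed
perturbation to the one picked by choice in `boundedPerturb`. -/
theorem IsPerturb.op_eq {T S : C0Semigroup E} (h : T.IsPerturb S 0) (t : ℝ≥0) :
    S.op t = T.op t := by
  ext f
  rw [← sub_eq_zero, duhamel h]
  simp

end Complete

end General

/-! ### Symmetric generators -/

section Symmetric

variable {H : Type*} [NormedAddCommGroup H] [InnerProductSpace ℂ H] [CompleteSpace H]

/-- The function `s ↦ ⟨S(t - s) f, S(s) g⟩` has right derivative zero by symmetry of the generator,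
so its values at `0` and `t` agree. -/
theorem inner_op_of_mem {S : C0Semigroup H}
    (hS : ∀ x x' y y', Tendsto (S.diffQuot x) (𝓝[>] 0) (𝓝 x') →
      Tendsto (S.diffQuot y) (𝓝[>] 0) (𝓝 y') → inner ℂ x' y = inner ℂ x y')
    (t : ℝ≥0) {f g : H} (hf : f ∈ S.generatorDomain) (hg : g ∈ S.generatorDomain) :
    inner ℂ (S.op t f) g = inner ℂ f (S.op t g) := by
  obtain ⟨f', hf⟩ := hf
  obtain ⟨g', hg⟩ := hg
  have hc : Continuous fun s : ℝ => inner ℂ (S.op (t - s).toNNReal f) (S.op s.toNNReal g) := by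
    fun_prop
  have key := intervalIntegral.integral_eq_sub_of_hasDeriv_right_of_le (a := 0) (b := (t : ℝ))
    (f' := fun _ => 0) t.2 hc.continuousOn (fun r hr => ?_) (by simp)
  · simp only [intervalIntegral.integral_zero, sub_self, sub_zero, Real.toNNReal_zero, S.op_zero,
      Real.toNNReal_coe, one_apply_eq_self] at key
    exact (sub_eq_zero.1 key.symm).symm
  · rw [hasDerivWithinAt_iff_tendsto_slope' (by simp)]
    have hx := S.tendsto_diffQuot_op r.toNNReal hg
    have hz := S.tendsto_diffQuot_op (t - r).toNNReal hf
    have h1 : Tendsto (fun x : ℝ => (t - x).toNNReal) (𝓝[>] r) (𝓝 (t - r).toNNReal) := by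
      refine tendsto_nhdsWithin_of_tendsto_nhds ?_
      have : Continuous fun x : ℝ => (t - x).toNNReal := by fun_prop
      exact this.tendsto r
    have h2 : Tendsto (fun x : ℝ => S.op (t - x).toNNReal f) (𝓝[>] r)
        (𝓝 (S.op (t - r).toNNReal f)) := ((S.continuous_op f).tendsto _).comp h1
    have h3 := (S.continuous_op_uncurry.tendsto _).comp
      (h1.prodMk_nhds (hf.comp (tendsto_toNNReal_sub_nhdsGT r)))
    have h4 := (h2.inner (𝕜 := ℂ) (hx.comp (tendsto_toNNReal_sub_nhdsGT r))).sub
      (h3.inner (𝕜 := ℂ) (tendsto_const_nhds (x := S.op r.toNNReal g)))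
    rw [hS _ _ _ _ hz hx, sub_self] at h4
    refine h4.congr' ?_
    filter_upwards [Ioo_mem_nhdsGT hr.2] with x hx
    have e1 : (t - r).toNNReal = (t - x).toNNReal + (x - r).toNNReal := by
      rw [← Real.toNNReal_add (by linarith [hx.2]) (by linarith [hx.1])]
      congr 1; ring
    have e2 : x.toNNReal = (x - r).toNNReal + r.toNNReal := by
      rw [← Real.toNNReal_add (by linarith [hx.1]) hr.1.le]
      congr 1; ring
    have e3 : (((x - r).toNNReal : ℝ) : ℂ)⁻¹ = (((x - r)⁻¹ : ℝ) : ℂ) := by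
      rw [Real.coe_toNNReal _ (by linarith [hx.1]), Complex.ofReal_inv]
    simp only [Function.comp_apply, diffQuot, slope_def_module, e1, e2, op_apply_add, e3,
      map_smul, map_sub, inner_smul_left, inner_smul_right, inner_sub_left, inner_sub_right,
      Complex.conj_ofReal, Complex.real_smul]
    ring

/-- A `C₀`-semigroup with symmetric generator consists of symmetric operators. -/
theorem inner_op {S : C0Semigroup H}
    (hS : ∀ x x' y y', Tendsto (S.diffQuot x) (𝓝[>] 0) (𝓝 x') →
      Tendsto (S.diffQuot y) (𝓝[>] 0) (𝓝 y') → inner ℂ x' y = inner ℂ x y')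
    (t : ℝ≥0) (f g : H) : inner ℂ (S.op t f) g = inner ℂ f (S.op t g) := by
  have h1 : ∀ g ∈ S.generatorDomain, ∀ f, inner ℂ (S.op t f) g = inner ℂ f (S.op t g) :=
    fun g hg => fun f => (isClosed_eq (f := fun f => inner ℂ (S.op t f) g)
      (g := fun f => inner ℂ f (S.op t g)) (by fun_prop) (by fun_prop)).closure_subset_iff.2
      (fun f hf => inner_op_of_mem hS t hf hg) (S.dense_generatorDomain f)
  exact (isClosed_eq (f := fun g => inner ℂ (S.op t f) g)
      (g := fun g => inner ℂ f (S.op t g)) (by fun_prop) (by fun_prop)).closure_subset_iff.2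
      (fun g hg => h1 g hg f) (S.dense_generatorDomain g)

theorem inner_of_tendsto_diffQuot {T : C0Semigroup H} (hT : ∀ t, _root_.IsSelfAdjoint (T.op t))
    {x x' y y' : H} (hx : Tendsto (T.diffQuot x) (𝓝[>] 0) (𝓝 x'))
    (hy : Tendsto (T.diffQuot y) (𝓝[>] 0) (𝓝 y')) : inner ℂ x' y = inner ℂ x y' := by
  refine tendsto_nhds_unique (hx.inner tendsto_const_nhds)
    ((tendsto_const_nhds.inner hy).congr fun t => ?_)
  have := (hT t).isSymmetric x y
  simp only [ContinuousLinearMap.coe_coe] at this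
  simp [diffQuot, inner_smul_left, inner_smul_right, inner_sub_left, inner_sub_right, this]

/-- Self-adjointness is preserved under bounded self-adjoint perturbations. -/
theorem IsPerturb.isSelfAdjoint_op {T S : C0Semigroup H} {B : H →L[ℂ] H} (h : T.IsPerturb S B)
    (hT : ∀ t, _root_.IsSelfAdjoint (T.op t)) (hB : _root_.IsSelfAdjoint B) (t : ℝ≥0) :
    _root_.IsSelfAdjoint (S.op t) := by
  rw [ContinuousLinearMap.isSelfAdjoint_iff_isSymmetric]
  refine inner_op (fun x x' y y' hx hy => ?_) t
  have := inner_of_tendsto_diffQuot hT ((h.symm _ _).1 hx) ((h.symm _ _).1 hy)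
  have hB' := hB.isSymmetric x y
  simp only [ContinuousLinearMap.coe_coe] at hB'
  simpa [inner_add_left, inner_add_right, hB'] using this

end Symmetric

/-! ### Bounded perturbations via the Volterra equation -/

section Existence

open BoundedContinuousFunction

variable {E : Type*} [NormedAddCommGroup E] [NormedSpace ℂ E] [CompleteSpace E]

omit [CompleteSpace E] in
theorem norm_integral_op_le {T : C0Semigroup E} {M κ : ℝ} (hκ : 0 < κ)
    (hT : ∀ t, ‖T.op t‖ ≤ M * Real.exp (-κ * t)) (t : ℝ≥0) {w : ℝ → E} {b : ℝ}
    (hw : ∀ s, ‖w s‖ ≤ b) :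
    ‖∫ s in (0 : ℝ)..t, T.op (t - s).toNNReal (w s)‖ ≤ M * b / κ := by
  have hM : 0 ≤ M := by simpa using (norm_nonneg _).trans (hT 0)
  have hb : 0 ≤ b := (norm_nonneg _).trans (hw 0)
  have h1 : ‖∫ s in (0 : ℝ)..t, T.op (t - s).toNNReal (w s)‖ ≤
      ∫ s in (0 : ℝ)..t, M * b * Real.exp (-κ * (t - s)) := by
    refine intervalIntegral.norm_integral_le_of_norm_le t.2 (.of_forall fun s hs => ?_)
      (Continuous.intervalIntegrable (by fun_prop) _ _)
    refine ((T.op _).le_of_opNorm_le (hT _) _).trans ?_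
    rw [Real.coe_toNNReal _ (sub_nonneg.2 hs.2), mul_right_comm]
    gcongr
    exact hw s
  refine h1.trans ?_
  have h2 : ∀ s ∈ Set.uIcc (0 : ℝ) t,
      HasDerivAt (fun s => M * b / κ * Real.exp (-κ * (t - s))) (M * b * Real.exp (-κ * (t - s))) s := by
    intro s _
    have := ((((hasDerivAt_id s).const_sub (t : ℝ)).const_mul (-κ)).exp).const_mul (M * b / κ)
    refine this.congr_deriv ?_
    simp only [id]
    field_simp
  rw [intervalIntegral.integral_eq_sub_of_hasDerivAt h2
    (Continuous.intervalIntegrable (by fun_prop) _ _)]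
  simp only [sub_self, mul_zero, Real.exp_zero, mul_one]
  have : 0 ≤ M * b / κ * Real.exp (-κ * (t - 0)) := by positivity
  linarith

omit [CompleteSpace E] in
theorem norm_integral_op_apply_le {T : C0Semigroup E} (B : E →L[ℂ] E) {M κ : ℝ} (hκ : 0 < κ)
    (hT : ∀ t, ‖T.op t‖ ≤ M * Real.exp (-κ * t)) (u : ℝ≥0 →ᵇ E) (t : ℝ≥0) :
    ‖∫ s in (0 : ℝ)..t, T.op (t - s).toNNReal (B (u s.toNNReal))‖ ≤ M * ‖B‖ / κ * ‖u‖ :=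
  (norm_integral_op_le hκ hT t fun _ => (B.le_opNorm _).trans
    (mul_le_mul_of_nonneg_left (u.norm_coe_le_norm _) (norm_nonneg _))).trans_eq (by ring)

/-- The Volterra operator `(K u)(t) = ∫₀ᵗ T(t - s) B u(s) ds` on bounded continuous functions, for
an exponentially stable semigroup `T`. -/
def volterra (T : C0Semigroup E) (B : E →L[ℂ] E) {M κ : ℝ} (hκ : 0 < κ)
    (hT : ∀ t, ‖T.op t‖ ≤ M * Real.exp (-κ * t)) : (ℝ≥0 →ᵇ E) →L[ℂ] (ℝ≥0 →ᵇ E) :=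
  have hc : ∀ u : ℝ≥0 →ᵇ E, ∀ t : ℝ≥0, Continuous fun s : ℝ =>
      T.op (t - s).toNNReal (B (u s.toNNReal)) := fun u t => by fun_prop
  LinearMap.mkContinuous
    { toFun := fun u => .ofNormedAddCommGroup
        (fun t : ℝ≥0 => ∫ s in (0 : ℝ)..t, T.op (t - s).toNNReal (B (u s.toNNReal)))
        (intervalIntegral.continuous_parametric_intervalIntegral_of_continuous
          (by simp only [Function.uncurry_def]; fun_prop) NNReal.continuous_coe) _
        (norm_integral_op_apply_le B hκ hT u)
      map_add' := fun u v => by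
        ext t
        simp only [BoundedContinuousFunction.coe_ofNormedAddCommGroup,
          BoundedContinuousFunction.coe_add, Pi.add_apply, map_add]
        exact intervalIntegral.integral_add ((hc u t).intervalIntegrable _ _)
          ((hc v t).intervalIntegrable _ _)
      map_smul' := fun c u => by
        ext t
        simp only [BoundedContinuousFunction.coe_ofNormedAddCommGroup,
          BoundedContinuousFunction.coe_smul, map_smul, RingHom.id_apply]
        exact intervalIntegral.integral_smul _ _ }
    (M * ‖B‖ / κ) fun u => by
      have hM : 0 ≤ M := by simpa using (norm_nonneg _).trans (hT 0)
      exact (BoundedContinuousFunction.norm_le (by positivity)).2 (norm_integral_op_apply_le B hκ hT u)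

theorem volterra_apply (T : C0Semigroup E) (B : E →L[ℂ] E) {M κ : ℝ} (hκ : 0 < κ)
    (hT : ∀ t, ‖T.op t‖ ≤ M * Real.exp (-κ * t)) (u : ℝ≥0 →ᵇ E) (t : ℝ≥0) :
    volterra T B hκ hT u t = ∫ s in (0 : ℝ)..t, T.op (t - s).toNNReal (B (u s.toNNReal)) := rfl

theorem norm_volterra_le (T : C0Semigroup E) (B : E →L[ℂ] E) {M κ : ℝ} (hκ : 0 < κ)
    (hT : ∀ t, ‖T.op t‖ ≤ M * Real.exp (-κ * t)) : ‖volterra T B hκ hT‖ ≤ M * ‖B‖ / κ := by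
  have hM : 0 ≤ M := by simpa using (norm_nonneg _).trans (hT 0)
  exact ContinuousLinearMap.opNorm_le_bound _ (by positivity) fun u =>
    (BoundedContinuousFunction.norm_le (by positivity)).2 (norm_integral_op_apply_le B hκ hT u)

/-- The orbit map `f ↦ T(·) f` of a bounded semigroup. -/
def orbit (T : C0Semigroup E) {M κ : ℝ} (hκ : 0 < κ)
    (hT : ∀ t, ‖T.op t‖ ≤ M * Real.exp (-κ * t)) : E →L[ℂ] (ℝ≥0 →ᵇ E) :=
  have hM : 0 ≤ M := by simpa using (norm_nonneg _).trans (hT 0)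
  have hb : ∀ (f : E) (t : ℝ≥0), ‖T.op t f‖ ≤ M * ‖f‖ := fun f t =>
    (T.op t).le_of_opNorm_le ((hT t).trans (mul_le_of_le_one_right hM
      (Real.exp_le_one_iff.2 (by have := t.2; nlinarith)))) f
  LinearMap.mkContinuous
    { toFun := fun f => .ofNormedAddCommGroup (fun t => T.op t f) (T.continuous_op f) _ (hb f)
      map_add' := fun f g => by ext t; simp
      map_smul' := fun c f => by ext t; simp }
    M fun f => (BoundedContinuousFunction.norm_le (by positivity)).2 (hb f)

/-- A translate of a solution solves the same equation with initial value `u t`; with uniqueness of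
solutions this becomes the semigroup law. -/
theorem volterra_translate (T : C0Semigroup E) (B : E →L[ℂ] E) {u : ℝ≥0 → E} {f : E}
    (hu : Continuous u) (h : ∀ t : ℝ≥0, u t = T.op t f +
      ∫ s in (0 : ℝ)..t, T.op (t - s).toNNReal (B (u s.toNNReal))) (s t : ℝ≥0) :
    u (s + t) = T.op s (u t) +
      ∫ r in (0 : ℝ)..s, T.op (s - r).toNNReal (B (u (r.toNNReal + t))) := by
  have hc : ∀ a : ℝ, Continuous fun r : ℝ => T.op (a - r).toNNReal (B (u r.toNNReal)) :=
    fun a => by fun_prop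
  have hi : ∀ a b c : ℝ, IntervalIntegrable
      (fun r : ℝ => T.op (a - r).toNNReal (B (u r.toNNReal))) volume b c :=
    fun a b c => (hc a).intervalIntegrable b c
  have e1 : ∫ r in (0 : ℝ)..t, T.op (((s + t : ℝ≥0) : ℝ) - r).toNNReal (B (u r.toNNReal)) =
      T.op s (∫ r in (0 : ℝ)..t, T.op (t - r).toNNReal (B (u r.toNNReal))) := by
    rw [← ContinuousLinearMap.intervalIntegral_comp_comm _ (hi _ _ _)]
    refine intervalIntegral.integral_congr fun r hr => ?_
    rw [Set.uIcc_of_le t.coe_nonneg] at hr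
    rw [← op_apply_add, NNReal.coe_add, add_sub_assoc,
      Real.toNNReal_add s.coe_nonneg (sub_nonneg.2 hr.2), Real.toNNReal_coe]
  have e2 : ∫ r in (t : ℝ)..((s + t : ℝ≥0) : ℝ),
      T.op (((s + t : ℝ≥0) : ℝ) - r).toNNReal (B (u r.toNNReal)) =
      ∫ r in (0 : ℝ)..s, T.op (s - r).toNNReal (B (u (r.toNNReal + t))) := by
    rw [NNReal.coe_add]
    have h1 := intervalIntegral.integral_comp_add_right (a := 0) (b := (s : ℝ))
      (fun r : ℝ => T.op ((s : ℝ) + t - r).toNNReal (B (u r.toNNReal))) (t : ℝ)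
    rw [zero_add] at h1
    rw [← h1]
    refine intervalIntegral.integral_congr fun r hr => ?_
    rw [Set.uIcc_of_le s.coe_nonneg] at hr
    rw [add_sub_add_right_eq_sub, Real.toNNReal_add hr.1 t.coe_nonneg, Real.toNNReal_coe]
  rw [h (s + t), ← intervalIntegral.integral_add_adjacent_intervals (hi _ 0 t) (hi _ t _), e1, e2,
    ← add_assoc, op_apply_add, ← map_add, ← h t]

/-- Perturbation of an exponentially stable semigroup by an operator that is small compared with
the decay rate. -/
theorem exists_isPerturb_of_decay {T : C0Semigroup E} {B : E →L[ℂ] E} {M κ : ℝ} (hκ : 0 < κ)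
    (hT : ∀ t, ‖T.op t‖ ≤ M * Real.exp (-κ * t)) (hB : M * ‖B‖ / κ < 1) :
    ∃ S : C0Semigroup E, T.IsPerturb S B ∧
      ∀ t f, HasSum (fun n => (volterra T B hκ hT ^ n) (orbit T hκ hT f) t) (S.op t f) := by
  set K := volterra T B hκ hT with hK
  have hK1 : ‖K‖ < 1 := (norm_volterra_le T B hκ hT).trans_lt hB
  set R := ∑' n : ℕ, K ^ n with hR
  have hKR : ∀ u, R u = u + K (R u) := fun u => by
    have := congr($(mul_neg_geom_series K hK1) u)
    rw [sub_mul, one_mul, _root_.sub_apply] at this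
    exact (sub_eq_iff_eq_add.1 this)
  have huniq : ∀ u, u = K u → u = 0 := fun u hu => by
    by_contra hne
    have h1 := K.le_opNorm u
    rw [← hu] at h1
    have := norm_pos_iff.2 hne
    nlinarith
  let u : E → (ℝ≥0 →ᵇ E) := fun f => R (orbit T hκ hT f)
  have hu : ∀ f t, u f t = T.op t f +
      ∫ s in (0 : ℝ)..t, T.op (t - s).toNNReal (B (u f s.toNNReal)) := fun f t => by
    have := congr($(hKR (orbit T hκ hT f)) t)
    exact this
  let S : C0Semigroup E :=
    { op := fun t => (BoundedContinuousFunction.evalCLM ℂ t) ∘L R ∘L orbit T hκ hT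
      op_zero := by
        ext f
        change u f 0 = f
        rw [hu]
        simp [T.op_zero]
      op_add := fun s t => by
        ext f
        change u f (s + t) = u (u f t) s
        have h1 := huniq ((u f).compContinuous ⟨fun s => s + t, by fun_prop⟩ - u (u f t)) ?_
        · exact sub_eq_zero.1 congr($h1 s)
        · rw [map_sub]
          ext r
          have h2 := volterra_translate T B (u f).continuous (hu f) r t
          have h3 := hu (u f t) r
          simp only [BoundedContinuousFunction.coe_sub, Pi.sub_apply,
            BoundedContinuousFunction.compContinuous_apply, ContinuousMap.coe_mk, hK,
            volterra_apply]
          rw [h2, h3]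
          abel
      continuous_op := fun f => (u f).continuous }
  have hS : ∀ t f, S.op t f = u f t := fun _ _ => rfl
  refine ⟨S, fun f g => ?_, fun t f => ?_⟩
  · have hm : Tendsto (fun t : ℝ≥0 => (t : ℝ)) (𝓝[>] 0) (𝓝[>] 0) := by
      refine tendsto_nhdsWithin_iff.2 ⟨tendsto_nhdsWithin_of_tendsto_nhds
        (NNReal.continuous_coe.tendsto' _ _ (by simp)), ?_⟩
      filter_upwards [self_mem_nhdsWithin] with t ht
      exact NNReal.coe_pos.2 ht
    have hc : Continuous (Function.uncurry fun t s : ℝ =>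
        T.op (t - s).toNNReal (B (u f s.toNNReal))) := by
      simp only [Function.uncurry_def]; fun_prop
    have h1 := (tendsto_inv_smul_integral hc 0).comp hm
    have h0 : u f 0 = f := by rw [hu]; simp [T.op_zero]
    simp only [sub_self, Real.toNNReal_zero, T.op_zero, h0, one_apply_eq_self] at h1
    have h2 : ∀ t : ℝ≥0, S.diffQuot f t = T.diffQuot f t + (((t : ℝ) : ℂ))⁻¹ •
        ∫ s in (0 : ℝ)..t, T.op (t - s).toNNReal (B (u f s.toNNReal)) := fun t => by
      simp only [diffQuot, hS, ← smul_add]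
      rw [hu f t]
      congr 1
      abel
    -- The two difference quotients differ by a convolution average that tends to `B f`.
    refine ⟨fun h => (h.add h1).congr fun t => ?_, fun h => ?_⟩
    · rw [h2]; simp
    · have := h.sub h1
      rw [add_sub_cancel_right] at this
      refine this.congr fun t => ?_
      rw [h2]; simp
  · have h1 : HasSum (fun n => K ^ n) R := (summable_geometric_of_norm_lt_one hK1).hasSum
    exact h1.mapL ((BoundedContinuousFunction.evalCLM ℂ t) ∘L
      (ContinuousLinearMap.apply ℂ (ℝ≥0 →ᵇ E) (orbit T hκ hT f)))

end Existence

/-! ### Order on `L_2`, multiplication operators and comparison of perturbed semigroups -/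

section Lp

variable {Ω : Type*} [MeasurableSpace Ω] {μ : Measure Ω}

theorem smul_nonneg_Lp {c : ℝ} (hc : 0 ≤ c) {f : Lp ℂ 2 μ} (hf : 0 ≤ f) : 0 ≤ c • f := by
  rw [← Lp.coeFn_nonneg] at hf ⊢
  filter_upwards [hf, Lp.coeFn_smul c f] with x h1 h2
  rw [h2]
  exact smul_nonneg hc h1

theorem ofReal_smul_nonneg_Lp {c : ℝ} (hc : 0 ≤ c) {f : Lp ℂ 2 μ} (hf : 0 ≤ f) :
    0 ≤ (c : ℂ) • f := by
  rw [Complex.coe_smul]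
  exact smul_nonneg_Lp hc hf

/-- This compatibility of order and scalars is what makes Bochner integrals of nonnegative elements
nonnegative. -/
instance : IsOrderedModule ℝ (Lp ℂ 2 μ) where
  smul_le_smul_of_nonneg_left c hc f g hfg := by
    rw [← sub_nonneg, ← smul_sub]
    exact smul_nonneg_Lp hc (sub_nonneg.2 hfg)
  smul_le_smul_of_nonneg_right f hf a b hab := by
    rw [← sub_nonneg, ← sub_smul]
    exact smul_nonneg_Lp (sub_nonneg.2 hab) hf

theorem intervalIntegral_nonneg_Lp {φ : ℝ → Lp ℂ 2 μ} (hφ : ∀ s, 0 ≤ φ s) {a b : ℝ} (hab : a ≤ b) :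
    0 ≤ ∫ s in a..b, φ s := by
  rw [intervalIntegral.integral_of_le hab]
  exact integral_nonneg hφ

theorem inner_nonneg_Lp {f g : Lp ℂ 2 μ} (hf : 0 ≤ f) (hg : 0 ≤ g) : 0 ≤ inner ℂ f g := by
  rw [← Lp.coeFn_nonneg] at hf hg
  rw [L2.inner_def]
  refine integral_nonneg_of_ae ?_
  filter_upwards [hf, hg] with x h1 h2
  change 0 ≤ inner ℂ (f x) (g x)
  rw [RCLike.inner_apply]
  refine mul_nonneg h2 ?_
  rwa [starRingEnd_apply, star_nonneg_iff]

/-- Multiplication by a real function in `L_∞(μ)`, as a bounded operator. -/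
def mulCLM (W : Lp ℝ ∞ μ) : Lp ℂ 2 μ →L[ℂ] Lp ℂ 2 μ :=
  (mulOp W).mkContinuous ‖W‖ fun f => Lp.norm_smul_le W f

theorem mulCLM_apply (W : Lp ℝ ∞ μ) (f : Lp ℂ 2 μ) : mulCLM W f = W • f := rfl

theorem coeFn_mulCLM (W : Lp ℝ ∞ μ) (f : Lp ℂ 2 μ) :
    mulCLM W f =ᵐ[μ] fun x => (W x : ℂ) * f x := by
  filter_upwards [Lp.coeFn_lpSMul (r := 2) W f] with x hx
  rw [mulCLM_apply, hx, Pi.smul_apply', Complex.real_smul]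

theorem isSelfAdjoint_mulCLM (W : Lp ℝ ∞ μ) : _root_.IsSelfAdjoint (mulCLM W) := by
  rw [ContinuousLinearMap.isSelfAdjoint_iff_isSymmetric]
  intro f g
  simp only [ContinuousLinearMap.coe_coe, L2.inner_def]
  refine integral_congr_ae ?_
  filter_upwards [coeFn_mulCLM W f, coeFn_mulCLM W g] with x h1 h2
  rw [h1, h2]
  simp only [RCLike.inner_apply, map_mul, Complex.conj_ofReal]
  ring

theorem mulCLM_sub_nonneg {W W' : Lp ℝ ∞ μ} (h : W' ≤ W) {f : Lp ℂ 2 μ} (hf : 0 ≤ f) :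
    0 ≤ (mulCLM W - mulCLM W') f := by
  rw [_root_.sub_apply, sub_nonneg, ← Lp.coeFn_le]
  rw [← Lp.coeFn_le] at h
  rw [← Lp.coeFn_nonneg] at hf
  filter_upwards [coeFn_mulCLM W f, coeFn_mulCLM W' f, h, hf] with x h1 h2 h3 h4
  rw [h1, h2]
  exact mul_le_mul_of_nonneg_right (Complex.real_le_real.2 h3) h4

theorem mulCLM_add_smul_one_nonneg {W : Lp ℝ ∞ μ} {c : ℝ} (h : ∀ᵐ x ∂μ, -c ≤ W x) {f : Lp ℂ 2 μ}
    (hf : 0 ≤ f) : 0 ≤ (mulCLM W + (c : ℂ) • 1) f := by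
  rw [← Lp.coeFn_nonneg] at hf ⊢
  simp only [_root_.add_apply, _root_.smul_apply, one_apply_eq_self]
  filter_upwards [coeFn_mulCLM W f, Lp.coeFn_smul (c : ℂ) f,
    Lp.coeFn_add (mulCLM W f) ((c : ℂ) • f), h, hf] with x h1 h2 h3 h4 h5
  rw [h3, Pi.add_apply, h1, h2, Pi.smul_apply, smul_eq_mul, ← add_mul, ← Complex.ofReal_add]
  exact mul_nonneg (Complex.zero_le_real.2 (by linarith)) h5

theorem smul_one_sub_mulCLM_nonneg (W : Lp ℝ ∞ μ) {f : Lp ℂ 2 μ} (hf : 0 ≤ f) :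
    0 ≤ ((‖W‖ : ℂ) • 1 - mulCLM W) f := by
  have h0 : ∀ᵐ x ∂μ, ‖W x‖ ≤ ‖W‖ := by
    have h := ae_le_eLpNormEssSup (f := W) (μ := μ)
    rw [← eLpNorm_exponent_top] at h
    filter_upwards [h] with x hx
    rw [Lp.norm_def, ← toReal_enorm]
    exact ENNReal.toReal_mono (Lp.eLpNorm_ne_top W) hx
  rw [← Lp.coeFn_nonneg] at hf ⊢
  simp only [_root_.sub_apply, _root_.smul_apply, one_apply_eq_self]
  filter_upwards [coeFn_mulCLM W f, Lp.coeFn_smul (‖W‖ : ℂ) f,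
    Lp.coeFn_sub ((‖W‖ : ℂ) • f) (mulCLM W f), h0, hf] with x h1 h2 h3 h4 h5
  rw [h3, Pi.sub_apply, h1, h2, Pi.smul_apply, smul_eq_mul, ← sub_mul, ← Complex.ofReal_sub]
  exact mul_nonneg (Complex.zero_le_real.2 (by linarith [le_abs_self (W x), Real.norm_eq_abs (W x)])) h5

theorem IsPositive.rescale {T : C0Semigroup (Lp ℂ 2 μ)} (hT : T.IsPositive) (c : ℝ) :
    (T.rescale c).IsPositive := fun t f hf =>
  ofReal_smul_nonneg_Lp (Real.exp_pos _).le (hT t f hf)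

theorem IsPositive.op_mono {T : C0Semigroup (Lp ℂ 2 μ)} (hT : T.IsPositive) (t : ℝ≥0)
    {f g : Lp ℂ 2 μ} (h : f ≤ g) : T.op t f ≤ T.op t g := by
  rw [← sub_nonneg, ← map_sub]
  exact hT t _ (sub_nonneg.2 h)

/-- The bounded perturbation theorem for multiplication operators and positive semigroups. -/
theorem exists_isPerturb_mulCLM {T : C0Semigroup (Lp ℂ 2 μ)} (hT : T.IsPositive) (W : Lp ℝ ∞ μ) :
    ∃ S : C0Semigroup (Lp ℂ 2 μ), T.IsPerturb S (-mulCLM W) ∧ S.IsPositive := by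
  obtain ⟨M, ω, hM, hω, hb⟩ := T.exists_norm_op_le
  -- The shift by `‖W‖` makes the perturbation positive, so that every term of the Neumann series is
  -- positive. The choice of `κ` makes `M * ‖B‖ / κ < 1`.
  set B : Lp ℂ 2 μ →L[ℂ] Lp ℂ 2 μ := (‖W‖ : ℂ) • 1 - mulCLM W with hB
  set κ : ℝ := M * ‖B‖ + 1 with hκ
  have hκ0 : 0 < κ := by positivity
  have hT' : ∀ t, ‖(T.rescale (-(ω + κ))).op t‖ ≤ M * Real.exp (-κ * t) := fun t => by
    change ‖(Real.exp (-(ω + κ) * t) : ℂ) • T.op t‖ ≤ _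
    rw [norm_smul, Complex.norm_real, Real.norm_of_nonneg (Real.exp_pos _).le]
    refine (mul_le_mul_of_nonneg_left (hb t) (Real.exp_pos _).le).trans_eq ?_
    rw [mul_left_comm, ← Real.exp_add]
    congr 2
    ring
  obtain ⟨S, hS, hsum⟩ := exists_isPerturb_of_decay hκ0 hT' (B := B)
    (by rw [div_lt_one hκ0, hκ]; linarith)
  have hpos : S.IsPositive := fun t f hf => by
    refine hasSum_le (fun n => ?_) hasSum_zero (hsum t f)
    induction n generalizing t with
    | zero => exact hT.rescale _ t f hf
    | succ n ih =>
      rw [pow_succ', mul_apply_eq_comp, volterra_apply]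
      exact intervalIntegral_nonneg_Lp (fun s => hT.rescale _ _ _
        (smul_one_sub_mulCLM_nonneg W (ih _))) t.coe_nonneg
  -- Undoes both shifts: `-(ω + κ) + (‖W‖ - W) + (ω + κ - ‖W‖) = -W`.
  refine ⟨S.rescale (ω + κ - ‖W‖), ?_, hpos.rescale _⟩
  have h := ((T.isPerturb_rescale (-(ω + κ))).trans hS).trans
    (S.isPerturb_rescale (ω + κ - ‖W‖))
  convert h using 1
  rw [hB]
  push_cast
  module

theorem tendsto_diffQuot_iff {E : Type*} [NormedAddCommGroup E] [NormedSpace ℂ E]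
    (T : C0Semigroup E) {f g : E} : Tendsto (T.diffQuot f) (𝓝[>] 0) (𝓝 g) ↔
      ∃ h : f ∈ T.generator.domain, T.generator ⟨f, h⟩ = g :=
  ⟨fun h => ⟨⟨g, h⟩, tendsto_nhds_unique (T.tendsto_generator _) h⟩,
    fun ⟨h, h'⟩ => h' ▸ T.tendsto_generator ⟨f, h⟩⟩

theorem IsPerturb.generator_eq {T S : C0Semigroup (Lp ℂ 2 μ)} {W : Lp ℝ ∞ μ}
    (h : T.IsPerturb S (-mulCLM W)) : S.generator = T.generator - (mulOp W).toPMap ⊤ := by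
  have h1 : ∀ f, ∀ hf : f ∈ T.generator.domain, ∃ hf' : f ∈ S.generator.domain,
      S.generator ⟨f, hf'⟩ = T.generator ⟨f, hf⟩ - mulOp W f := fun f hf => by
    have := (h f _).1 (T.tendsto_generator ⟨f, hf⟩)
    rw [tendsto_diffQuot_iff, _root_.neg_apply, ← sub_eq_add_neg] at this
    exact this
  refine LinearPMap.ext ?_ fun f hf hf' => ?_
  · ext f
    rw [LinearPMap.sub_domain, LinearMap.toPMap_domain, inf_top_eq]
    refine ⟨fun hf => ?_, fun hf => (h1 f hf).1⟩
    have := (h.symm f _).1 (S.tendsto_generator ⟨f, hf⟩)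
    exact (tendsto_diffQuot_iff _).1 this |>.1
  · exact (h1 f hf'.1).2

theorem isPerturb_of_generator_eq {T S : C0Semigroup (Lp ℂ 2 μ)} {W : Lp ℝ ∞ μ}
    (h : S.generator = T.generator - (mulOp W).toPMap ⊤) : T.IsPerturb S (-mulCLM W) := by
  have h1 : ∀ f, ∀ hf : f ∈ T.generator.domain,
      Tendsto (S.diffQuot f) (𝓝[>] 0) (𝓝 (T.generator ⟨f, hf⟩ - mulOp W f)) := fun f hf => by
    rw [tendsto_diffQuot_iff, h]
    exact ⟨⟨hf, Submodule.mem_top⟩, rfl⟩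
  intro f g
  rw [_root_.neg_apply, ← sub_eq_add_neg]
  refine ⟨fun hf => ?_, fun hf => ?_⟩
  · obtain ⟨hf', rfl⟩ := T.tendsto_diffQuot_iff.1 hf
    exact h1 f hf'
  · obtain ⟨hf', -⟩ := S.tendsto_diffQuot_iff.1 hf
    rw [h] at hf'
    have := tendsto_nhds_unique hf (h1 f hf'.1)
    rw [sub_left_inj.1 this]
    exact T.tendsto_generator ⟨f, hf'.1⟩

variable {T : C0Semigroup (Lp ℂ 2 μ)}

theorem isPerturb_boundedPerturb (hT : T.IsPositive) (W : Lp ℝ ∞ μ) :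
    T.IsPerturb (T.boundedPerturb W) (-mulCLM W) := by
  obtain ⟨S, hS, -⟩ := exists_isPerturb_mulCLM hT W
  have h : ∃ S : C0Semigroup (Lp ℂ 2 μ), S.generator = T.generator - (mulOp W).toPMap ⊤ :=
    ⟨S, hS.generator_eq⟩
  rw [boundedPerturb, dif_pos h]
  exact isPerturb_of_generator_eq h.choose_spec

theorem boundedPerturb_isPositive (hT : T.IsPositive) (W : Lp ℝ ∞ μ) :
    (T.boundedPerturb W).IsPositive := by
  obtain ⟨S, hS, hpos⟩ := exists_isPerturb_mulCLM hT W
  have h := hS.symm.trans (isPerturb_boundedPerturb hT W)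
  rw [neg_add_cancel] at h
  intro t f hf
  rw [h.op_eq]
  exact hpos t f hf

theorem boundedPerturb_isSelfAdjoint (hT : T.IsPositive) (hT' : T.IsSelfAdjoint) (W : Lp ℝ ∞ μ) :
    (T.boundedPerturb W).IsSelfAdjoint :=
  (isPerturb_boundedPerturb hT W).isSelfAdjoint_op hT' (isSelfAdjoint_mulCLM W).neg

theorem isPerturb_boundedPerturb_boundedPerturb (hT : T.IsPositive) (W W' : Lp ℝ ∞ μ) :
    (T.boundedPerturb W).IsPerturb (T.boundedPerturb W') (mulCLM W - mulCLM W') := by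
  have h := (isPerturb_boundedPerturb hT W).symm.trans (isPerturb_boundedPerturb hT W')
  rwa [neg_neg, ← sub_eq_add_neg] at h

/-- A positive perturbation of the generator increases a positive semigroup. -/
theorem IsPerturb.op_le_op {S S' : C0Semigroup (Lp ℂ 2 μ)} {B : Lp ℂ 2 μ →L[ℂ] Lp ℂ 2 μ}
    (h : S.IsPerturb S' B) (hS : S.IsPositive) (hS' : S'.IsPositive)
    (hB : ∀ f : Lp ℂ 2 μ, 0 ≤ f → 0 ≤ B f) (t : ℝ≥0) {f : Lp ℂ 2 μ} (hf : 0 ≤ f) :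
    S.op t f ≤ S'.op t f := by
  rw [← sub_nonneg, duhamel h]
  exact intervalIntegral_nonneg_Lp (fun s => hS' _ _ (hB _ (hS _ _ hf))) t.coe_nonneg

theorem boundedPerturb_anti (hT : T.IsPositive) {W W' : Lp ℝ ∞ μ} (h : W' ≤ W) (t : ℝ≥0)
    {f : Lp ℂ 2 μ} (hf : 0 ≤ f) : (T.boundedPerturb W).op t f ≤ (T.boundedPerturb W').op t f :=
  (isPerturb_boundedPerturb_boundedPerturb hT W W').op_le_op (boundedPerturb_isPositive hT W)
    (boundedPerturb_isPositive hT W') (fun _ hf => mulCLM_sub_nonneg h hf) t hf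

/-- The semigroup `e^{ct} T(t)` has generator `A + c`, which exceeds `A - W` by the positive
operator `W + c`. -/
theorem boundedPerturb_le_exp_smul (hT : T.IsPositive) {W : Lp ℝ ∞ μ} {c : ℝ}
    (h : ∀ᵐ x ∂μ, -c ≤ W x) (t : ℝ≥0) {f : Lp ℂ 2 μ} (hf : 0 ≤ f) :
    (T.boundedPerturb W).op t f ≤ (Real.exp (c * t) : ℂ) • T.op t f := by
  have h1 := (isPerturb_boundedPerturb hT W).symm.trans (T.isPerturb_rescale c)
  rw [neg_neg] at h1
  exact h1.op_le_op (boundedPerturb_isPositive hT W) (hT.rescale c)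
    (fun _ hf => mulCLM_add_smul_one_nonneg h hf) t hf

/-- The effect of lowering the potential is larger for smaller potentials. -/
theorem boundedPerturb_sub_le_sub (hT : T.IsPositive) {W W' Z Z' : Lp ℝ ∞ μ} (hW : W' ≤ W)
    (hZW : Z ≤ W) (hZW' : Z' ≤ W') (h : mulCLM W - mulCLM W' = mulCLM Z - mulCLM Z')
    (t : ℝ≥0) {f : Lp ℂ 2 μ} (hf : 0 ≤ f) :
    (T.boundedPerturb W').op t f - (T.boundedPerturb W).op t f ≤
      (T.boundedPerturb Z').op t f - (T.boundedPerturb Z).op t f := by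
  have hU : ∀ f : Lp ℂ 2 μ, 0 ≤ f → 0 ≤ (mulCLM Z - mulCLM Z') f := fun f hf =>
    h ▸ mulCLM_sub_nonneg hW hf
  -- Both differences are integrals of `T_{W'}(t - s) U T_W(s) f` and `T_{Z'}(t - s) U T_Z(s) f`
  -- with the same positive `U`, and each semigroup factor grows when the potential decreases.
  rw [duhamel (isPerturb_boundedPerturb_boundedPerturb hT W W'), h,
    duhamel (isPerturb_boundedPerturb_boundedPerturb hT Z Z'), ← sub_nonneg,
    ← intervalIntegral.integral_sub (Continuous.intervalIntegrable (by fun_prop) _ _)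
      (Continuous.intervalIntegrable (by fun_prop) _ _)]
  refine intervalIntegral_nonneg_Lp (fun s => sub_nonneg.2 ?_) t.coe_nonneg
  refine (boundedPerturb_anti hT hZW' _ (hU _ (boundedPerturb_isPositive hT W _ _ hf))).trans
    ((boundedPerturb_isPositive hT Z').op_mono _ ?_)
  rw [← sub_nonneg, ← map_sub]
  exact hU _ (sub_nonneg.2 (boundedPerturb_anti hT hZW _ hf))

end Lp

/-! ### Strong limits of operators -/

section StrongLimits

variable {E : Type*} [NormedAddCommGroup E] [NormedSpace ℂ E] [CompleteSpace E]

/-- Strong convergence of sequences is uniformly bounded by Banach–Steinhaus, so products pass to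
the limit. -/
theorem tendsto_apply_of_tendsto {A : ℕ → E →L[ℂ] E} {A' : E →L[ℂ] E}
    (hA : ∀ f, Tendsto (fun n => A n f) atTop (𝓝 (A' f))) {x : ℕ → E} {y : E}
    (hx : Tendsto x atTop (𝓝 y)) : Tendsto (fun n => A n (x n)) atTop (𝓝 (A' y)) := by
  obtain ⟨C, hC⟩ := banach_steinhaus fun f => by
    obtain ⟨C, hC⟩ := (hA f).norm.bddAbove_range
    exact ⟨C, fun n => hC ⟨n, rfl⟩⟩
  have h1 : Tendsto (fun n => A n (x n - y)) atTop (𝓝 0) := by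
    refine squeeze_zero_norm (fun n => (A n).le_of_opNorm_le (hC n) _) ?_
    simpa using (tendsto_iff_norm_sub_tendsto_zero.1 hx).const_mul C
  simpa using h1.add (hA y)

end StrongLimits

/-! ### Monotone limits and contractivity on `L_2` -/

section Lp

variable {Ω : Type*} [MeasurableSpace Ω] {μ : Measure Ω}

/-- The cross term `⟨a, b - a⟩` is nonnegative. This yields convergence of decreasing sequences,
whose norms converge. -/
theorem norm_sub_sq_le_of_le {a b : Lp ℂ 2 μ} (ha : 0 ≤ a) (hab : a ≤ b) :
    ‖b - a‖ ^ 2 ≤ ‖b‖ ^ 2 - ‖a‖ ^ 2 := by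
  have h1 := norm_add_sq (𝕜 := ℂ) a (b - a)
  have h2 := (Complex.nonneg_iff.1 (inner_nonneg_Lp ha (sub_nonneg.2 hab))).1
  rw [add_sub_cancel] at h1
  change ‖b‖ ^ 2 = ‖a‖ ^ 2 + 2 * (inner ℂ a (b - a)).re + _ at h1
  linarith

theorem norm_le_norm_of_le {a b : Lp ℂ 2 μ} (ha : 0 ≤ a) (hab : a ≤ b) : ‖a‖ ≤ ‖b‖ := by
  have h := norm_sub_sq_le_of_le ha hab
  refine le_of_sq_le_sq ?_ (norm_nonneg _)
  nlinarith [sq_nonneg ‖b - a‖]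

theorem exists_tendsto_of_antitone {x : ℕ → Lp ℂ 2 μ} (hx : Antitone x) (h0 : ∀ n, 0 ≤ x n) :
    ∃ y, Tendsto x atTop (𝓝 y) := by
  have hanti : Antitone fun n => ‖x n‖ ^ 2 := fun m n h => by
    have := norm_le_norm_of_le (h0 n) (hx h)
    simp only
    gcongr
  have hbdd : BddBelow (Set.range fun n => ‖x n‖ ^ 2) := ⟨0, by rintro _ ⟨n, rfl⟩; positivity⟩
  have hlim := tendsto_atTop_ciInf hanti hbdd
  refine cauchySeq_tendsto_of_complete (cauchySeq_of_le_tendsto_0'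
    (fun n => √(‖x n‖ ^ 2 - ⨅ k, ‖x k‖ ^ 2)) (fun n m h => ?_) ?_)
  · rw [dist_eq_norm]
    refine Real.le_sqrt_of_sq_le ((norm_sub_sq_le_of_le (h0 m) (hx h)).trans ?_)
    exact sub_le_sub_left (ciInf_le hbdd m) _
  · have := (hlim.sub_const (⨅ k, ‖x k‖ ^ 2)).sqrt
    simpa using this

theorem exists_nonneg_comp_Lp (f : Lp ℂ 2 μ) {φ : ℂ → ℝ} (hφ : Continuous φ) (h0 : ∀ z, 0 ≤ φ z)
    (h1 : ∀ z, φ z ≤ ‖z‖) : ∃ g : Lp ℂ 2 μ, 0 ≤ g ∧ ‖g‖ ≤ ‖f‖ ∧ ∀ᵐ x ∂μ, g x = φ (f x) := by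
  have hm : MemLp (fun x => (φ (f x) : ℂ)) 2 μ := by
    refine (Lp.memLp f).of_le ((Complex.continuous_ofReal.comp hφ).comp_aestronglyMeasurable
      (Lp.aestronglyMeasurable f)) (.of_forall fun x => ?_)
    rw [Complex.norm_real, Real.norm_of_nonneg (h0 _)]
    exact h1 _
  refine ⟨hm.toLp, ?_, Lp.norm_le_norm_of_ae_le ?_, hm.coeFn_toLp⟩
  · rw [← Lp.coeFn_nonneg]
    filter_upwards [hm.coeFn_toLp] with x hx
    rw [hx]
    exact Complex.zero_le_real.2 (h0 _)
  · filter_upwards [hm.coeFn_toLp] with x hx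
    rw [hx, Complex.norm_real, Real.norm_of_nonneg (h0 _)]
    exact h1 _

/-- Every function in `L_2` is a combination of four nonnegative functions of smaller norm. -/
theorem exists_decomposition (f : Lp ℂ 2 μ) : ∃ a b c d : Lp ℂ 2 μ,
    (0 ≤ a ∧ ‖a‖ ≤ ‖f‖) ∧ (0 ≤ b ∧ ‖b‖ ≤ ‖f‖) ∧ (0 ≤ c ∧ ‖c‖ ≤ ‖f‖) ∧ (0 ≤ d ∧ ‖d‖ ≤ ‖f‖) ∧
      f = a - b + Complex.I • (c - d) := by
  have hre : ∀ z : ℂ, |z.re| ≤ ‖z‖ := Complex.abs_re_le_norm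
  have him : ∀ z : ℂ, |z.im| ≤ ‖z‖ := Complex.abs_im_le_norm
  obtain ⟨a, ha, ha', ha''⟩ := exists_nonneg_comp_Lp f (φ := fun z => max z.re 0) (by fun_prop)
    (fun z => le_max_right _ _) fun z => max_le ((le_abs_self _).trans (hre z)) (norm_nonneg _)
  obtain ⟨b, hb, hb', hb''⟩ := exists_nonneg_comp_Lp f (φ := fun z => max (-z.re) 0) (by fun_prop)
    (fun z => le_max_right _ _) fun z => max_le ((neg_le_abs _).trans (hre z)) (norm_nonneg _)
  obtain ⟨c, hc, hc', hc''⟩ := exists_nonneg_comp_Lp f (φ := fun z => max z.im 0) (by fun_prop)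
    (fun z => le_max_right _ _) fun z => max_le ((le_abs_self _).trans (him z)) (norm_nonneg _)
  obtain ⟨d, hd, hd', hd''⟩ := exists_nonneg_comp_Lp f (φ := fun z => max (-z.im) 0) (by fun_prop)
    (fun z => le_max_right _ _) fun z => max_le ((neg_le_abs _).trans (him z)) (norm_nonneg _)
  refine ⟨a, b, c, d, ⟨ha, ha'⟩, ⟨hb, hb'⟩, ⟨hc, hc'⟩, ⟨hd, hd'⟩, Lp.ext ?_⟩
  have hmax : ∀ r : ℝ, r = max r 0 - max (-r) 0 := fun r => by
    rcases le_total r 0 with h | h <;> simp [h]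
  filter_upwards [ha'', hb'', hc'', hd'', Lp.coeFn_add (a - b) (Complex.I • (c - d)),
    Lp.coeFn_sub a b, Lp.coeFn_sub c d, Lp.coeFn_smul Complex.I (c - d)] with x h1 h2 h3 h4 h5 h6 h7 h8
  rw [h5, Pi.add_apply, h6, h8, Pi.smul_apply, h7, Pi.sub_apply, Pi.sub_apply, h1, h2, h3, h4,
    ← Complex.ofReal_sub, ← Complex.ofReal_sub, ← hmax, ← hmax, smul_eq_mul, mul_comm,
    Complex.re_add_im]

theorem exists_strong_limit {A : ℕ → Lp ℂ 2 μ →L[ℂ] Lp ℂ 2 μ}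
    (hA : ∀ f : Lp ℂ 2 μ, 0 ≤ f → ∃ y, Tendsto (fun n => A n f) atTop (𝓝 y)) :
    ∃ L : Lp ℂ 2 μ →L[ℂ] Lp ℂ 2 μ, ∀ f, Tendsto (fun n => A n f) atTop (𝓝 (L f)) := by
  have h : ∀ f, ∃ y, Tendsto (fun n => A n f) atTop (𝓝 y) := fun f => by
    obtain ⟨a, b, c, d, ⟨ha, -⟩, ⟨hb, -⟩, ⟨hc, -⟩, ⟨hd, -⟩, rfl⟩ := exists_decomposition f
    obtain ⟨ya, ha⟩ := hA a ha
    obtain ⟨yb, hb⟩ := hA b hb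
    obtain ⟨yc, hc⟩ := hA c hc
    obtain ⟨yd, hd⟩ := hA d hd
    refine ⟨_, ((ha.sub hb).add ((hc.sub hd).const_smul Complex.I)).congr fun n => ?_⟩
    simp
  choose y hy using h
  exact ⟨continuousLinearMapOfTendsto A (tendsto_pi_nhds.2 hy), hy⟩

/-- A self-adjoint semigroup that is contractive on nonnegative functions is contractive. -/
theorem norm_le_one_of_nonneg {P : ℝ≥0 → Lp ℂ 2 μ →L[ℂ] Lp ℂ 2 μ}
    (hadd : ∀ s t, P (s + t) = P s * P t) (hsa : ∀ t, _root_.IsSelfAdjoint (P t))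
    (hP : ∀ t, ∀ f : Lp ℂ 2 μ, 0 ≤ f → ‖P t f‖ ≤ ‖f‖) (t : ℝ≥0) : ‖P t‖ ≤ 1 := by
  have h4 : ∀ t, ‖P t‖ ≤ 4 := fun t => by
    refine ContinuousLinearMap.opNorm_le_bound _ (by norm_num) fun f => ?_
    obtain ⟨a, b, c, d, ⟨ha, ha'⟩, ⟨hb, hb'⟩, ⟨hc, hc'⟩, ⟨hd, hd'⟩, hf⟩ := exists_decomposition f
    have e : P t f = P t a - P t b + Complex.I • (P t c - P t d) := by
      conv_lhs => rw [hf]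
      simp
    rw [e]
    refine (norm_add_le _ _).trans ?_
    rw [norm_smul, Complex.norm_I, one_mul]
    linarith [norm_sub_le (P t a) (P t b), norm_sub_le (P t c) (P t d), hP t a ha, hP t b hb,
      hP t c hc, hP t d hd]
  -- Self-adjointness gives `‖P (2t)‖ = ‖P t‖ ^ 2`, so a uniform bound by any constant improves to
  -- `1`. The `4` counts the nonnegative parts of a complex function.
  have hpow : ∀ k : ℕ, ∀ t, ‖P t‖ ^ 2 ^ k ≤ 4 := by
    intro k
    induction k with
    | zero => simpa using h4
    | succ k ih =>
      intro t
      have h2 : ‖P (t + t)‖ = ‖P t‖ ^ 2 := by rw [hadd, (hsa t).norm_mul_self]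
      rw [pow_succ', pow_mul, ← h2]
      exact ih _
  by_contra! hlt
  have h1 := (tendsto_pow_atTop_atTop_of_one_lt hlt).comp
    (tendsto_pow_atTop_atTop_of_one_lt (one_lt_two (α := ℕ)))
  obtain ⟨k, hk⟩ := (h1.eventually_gt_atTop 4).exists
  exact absurd (hpow k t) (not_le.2 hk)

/-! ### Truncated potentials and existence of `T_V(t)` -/

section Potential

variable {V : Ω → ℝ}

variable (μ) in
/-- The bounded potential `(V ∧ m) ∨ (-n)`. -/
def truncation₂ (hV : Measurable V) (m n : ℕ) : Lp ℝ ∞ μ :=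
  MemLp.toLp (fun x => max (min (V x) m) (-n)) <|
    memLp_top_of_bound ((hV.min measurable_const).max measurable_const).aestronglyMeasurable
      (max m n : ℝ) (.of_forall fun x => by
        rw [Real.norm_eq_abs, abs_le]
        have hm : (0 : ℝ) ≤ m := m.cast_nonneg
        have hn : (0 : ℝ) ≤ n := n.cast_nonneg
        exact ⟨(neg_le_neg (le_max_right _ _)).trans (le_max_right _ _),
          max_le ((min_le_right _ _).trans (le_max_left _ _))
            ((neg_nonpos.2 hn).trans (hm.trans (le_max_left _ _)))⟩)

theorem coeFn_truncation₂ (hV : Measurable V) (m n : ℕ) :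
    truncation₂ μ hV m n =ᵐ[μ] fun x => max (min (V x) m) (-n) := MemLp.coeFn_toLp _

theorem truncation_min_zero_eq (hV : Measurable V) (n : ℕ) :
    truncation μ (V := fun x => min (V x) 0) (hV.min measurable_const) n =
      truncation₂ μ hV 0 n := by
  refine MemLp.toLp_congr _ _ (.of_forall fun x => ?_)
  have hn : (0 : ℝ) ≤ n := n.cast_nonneg
  simp [hn]

theorem truncation₂_mono (hV : Measurable V) {m m' : ℕ} (h : m ≤ m') (n : ℕ) :
    truncation₂ μ hV m n ≤ truncation₂ μ hV m' n := by
  rw [← Lp.coeFn_le]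
  filter_upwards [coeFn_truncation₂ (μ := μ) hV m n, coeFn_truncation₂ (μ := μ) hV m' n]
    with x h1 h2
  rw [h1, h2]
  have : (m : ℝ) ≤ m' := mod_cast h
  gcongr

theorem truncation₂_anti (hV : Measurable V) (m : ℕ) {n n' : ℕ} (h : n ≤ n') :
    truncation₂ μ hV m n' ≤ truncation₂ μ hV m n := by
  rw [← Lp.coeFn_le]
  filter_upwards [coeFn_truncation₂ (μ := μ) hV m n, coeFn_truncation₂ (μ := μ) hV m n']
    with x h1 h2
  rw [h1, h2]
  have : (n : ℝ) ≤ n' := mod_cast h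
  gcongr

theorem neg_le_truncation₂ (hV : Measurable V) (m n : ℕ) :
    ∀ᵐ x ∂μ, -(n : ℝ) ≤ truncation₂ μ hV m n x := by
  filter_upwards [coeFn_truncation₂ (μ := μ) hV m n] with x h1
  rw [h1]
  exact le_max_right _ _

/-- Changing the lower cutoff only matters where `V < 0`, and there the upper cutoff `m ≥ 0` has no
effect. -/
theorem mulCLM_truncation₂_sub (hV : Measurable V) (m n n' : ℕ) :
    mulCLM (truncation₂ μ hV m n) - mulCLM (truncation₂ μ hV m n') =
      mulCLM (truncation₂ μ hV 0 n) - mulCLM (truncation₂ μ hV 0 n') := by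
  ext1 f
  refine Lp.ext ?_
  simp only [_root_.sub_apply]
  filter_upwards [coeFn_mulCLM (truncation₂ μ hV m n) f, coeFn_mulCLM (truncation₂ μ hV m n') f,
    coeFn_mulCLM (truncation₂ μ hV 0 n) f, coeFn_mulCLM (truncation₂ μ hV 0 n') f,
    Lp.coeFn_sub (mulCLM (truncation₂ μ hV m n) f) (mulCLM (truncation₂ μ hV m n') f),
    Lp.coeFn_sub (mulCLM (truncation₂ μ hV 0 n) f) (mulCLM (truncation₂ μ hV 0 n') f),
    coeFn_truncation₂ (μ := μ) hV m n, coeFn_truncation₂ (μ := μ) hV m n',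
    coeFn_truncation₂ (μ := μ) hV 0 n, coeFn_truncation₂ (μ := μ) hV 0 n']
    with x h1 h2 h3 h4 h5 h6 h7 h8 h9 h10
  rw [h5, h6, Pi.sub_apply, Pi.sub_apply, h1, h2, h3, h4, ← sub_mul, ← sub_mul,
    ← Complex.ofReal_sub, ← Complex.ofReal_sub, h7, h8, h9, h10]
  congr 2
  have hm : (0 : ℝ) ≤ m := m.cast_nonneg
  have hn : (0 : ℝ) ≤ n := n.cast_nonneg
  have hn' : (0 : ℝ) ≤ n' := n'.cast_nonneg
  rw [Nat.cast_zero]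
  rcases le_total (V x) 0 with h | h
  · rw [min_eq_left h, min_eq_left (h.trans hm)]
  · have h0 : 0 ≤ min (V x) m := le_min h hm
    rw [min_eq_right h, max_eq_left (by linarith), max_eq_left (by linarith),
      max_eq_left (by linarith), max_eq_left (by linarith)]
    simp

variable {T : C0Semigroup (Lp ℂ 2 μ)}

theorem exists_tendsto_truncation₂ (hT : T.IsPositive) (hV : Measurable V) (n : ℕ) (t : ℝ≥0) :
    ∃ P : Lp ℂ 2 μ →L[ℂ] Lp ℂ 2 μ, ∀ f, Tendsto
      (fun m => (T.boundedPerturb (truncation₂ μ hV m n)).op t f) atTop (𝓝 (P f)) :=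
  exists_strong_limit fun _ hf => exists_tendsto_of_antitone
    (fun _ _ h => boundedPerturb_anti hT (truncation₂_mono hV h n) t hf)
    fun _ => boundedPerturb_isPositive hT _ t _ hf

/-- The operators `T_{V ∨ (-n)}(t)`, as strong limits of `T_{(V ∧ m) ∨ (-n)}(t)` as `m → ∞`. -/
def lowerPerturb (hT : T.IsPositive) (hV : Measurable V) (n : ℕ) (t : ℝ≥0) :
    Lp ℂ 2 μ →L[ℂ] Lp ℂ 2 μ := (exists_tendsto_truncation₂ hT hV n t).choose

theorem tendsto_lowerPerturb (hT : T.IsPositive) (hV : Measurable V) (n : ℕ) (t : ℝ≥0)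
    (f : Lp ℂ 2 μ) : Tendsto (fun m => (T.boundedPerturb (truncation₂ μ hV m n)).op t f) atTop
      (𝓝 (lowerPerturb hT hV n t f)) := (exists_tendsto_truncation₂ hT hV n t).choose_spec f

theorem lowerPerturb_add (hT : T.IsPositive) (hV : Measurable V) (n : ℕ) (s t : ℝ≥0) :
    lowerPerturb hT hV n (s + t) = lowerPerturb hT hV n s * lowerPerturb hT hV n t := by
  ext1 f
  refine tendsto_nhds_unique (tendsto_lowerPerturb hT hV n (s + t) f) ?_
  refine (tendsto_apply_of_tendsto (tendsto_lowerPerturb hT hV n s)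
    (tendsto_lowerPerturb hT hV n t f)).congr fun m => ?_
  rw [op_apply_add]

theorem lowerPerturb_isSelfAdjoint (hT : T.IsPositive) (hT' : T.IsSelfAdjoint) (hV : Measurable V)
    (n : ℕ) (t : ℝ≥0) : _root_.IsSelfAdjoint (lowerPerturb hT hV n t) := by
  rw [ContinuousLinearMap.isSelfAdjoint_iff_isSymmetric]
  intro f g
  refine tendsto_nhds_unique ((tendsto_lowerPerturb hT hV n t f).inner tendsto_const_nhds)
    ((tendsto_const_nhds.inner (tendsto_lowerPerturb hT hV n t g)).congr fun m => ?_)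
  exact ((boundedPerturb_isSelfAdjoint hT hT' _ t).isSymmetric f g).symm

theorem lowerPerturb_nonneg (hT : T.IsPositive) (hV : Measurable V) (n : ℕ) (t : ℝ≥0)
    {f : Lp ℂ 2 μ} (hf : 0 ≤ f) : 0 ≤ lowerPerturb hT hV n t f :=
  ge_of_tendsto' (tendsto_lowerPerturb hT hV n t f) fun _ => boundedPerturb_isPositive hT _ t _ hf

theorem lowerPerturb_le_exp_smul (hT : T.IsPositive) (hV : Measurable V) (n : ℕ) (t : ℝ≥0)
    {f : Lp ℂ 2 μ} (hf : 0 ≤ f) :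
    lowerPerturb hT hV n t f ≤ (Real.exp (n * t) : ℂ) • T.op t f :=
  le_of_tendsto' (tendsto_lowerPerturb hT hV n t f) fun m =>
    boundedPerturb_le_exp_smul hT (neg_le_truncation₂ hV m n) t hf

theorem lowerPerturb_le (hT : T.IsPositive) (hV : Measurable V) {t : ℝ≥0}
    {L : Lp ℂ 2 μ →L[ℂ] Lp ℂ 2 μ} (hL : T.IsPerturbLimit hV t L) (n : ℕ)
    {f : Lp ℂ 2 μ} (hf : 0 ≤ f) : lowerPerturb hT hV n t f ≤ L f := by
  refine le_of_tendsto_of_tendsto (tendsto_lowerPerturb hT hV n t f) (hL f) ?_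
  filter_upwards [eventually_ge_atTop n] with m hm
  exact boundedPerturb_anti hT (truncation₂_anti hV m hm) t hf

/-- The bound does not depend on `m`; this uniformity allows the limits in `m` and `n` to be
interchanged. -/
theorem norm_boundedPerturb_truncation₂_sub_le (hT : T.IsPositive) (hV : Measurable V) (m : ℕ)
    {n n' : ℕ} (h : n ≤ n') (t : ℝ≥0) {f : Lp ℂ 2 μ} (hf : 0 ≤ f) :
    ‖(T.boundedPerturb (truncation₂ μ hV m n')).op t f -
        (T.boundedPerturb (truncation₂ μ hV m n)).op t f‖ ≤
      ‖(T.boundedPerturb (truncation₂ μ hV 0 n')).op t f -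
        (T.boundedPerturb (truncation₂ μ hV 0 n)).op t f‖ := by
  refine norm_le_norm_of_le (sub_nonneg.2 ?_) ?_
  · exact boundedPerturb_anti hT (truncation₂_anti hV m h) t hf
  · exact boundedPerturb_sub_le_sub hT (truncation₂_anti hV m h)
      (truncation₂_mono hV (Nat.zero_le m) n) (truncation₂_mono hV (Nat.zero_le m) n')
      (mulCLM_truncation₂_sub hV m n n') t hf

/-- Convergence for `-V⁻` implies convergence for `V`, also when the truncation parameters
from above and from below are sent to infinity one after the other. -/
theorem exists_isPerturbLimit (hT : T.IsPositive) (hV : Measurable V) (t : ℝ≥0)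
    (h : ∀ f, ∃ y, Tendsto (fun n => (T.boundedPerturb (truncation₂ μ hV 0 n)).op t f)
      atTop (𝓝 y)) :
    ∃ L : Lp ℂ 2 μ →L[ℂ] Lp ℂ 2 μ, T.IsPerturbLimit hV t L ∧
      ∀ f, 0 ≤ f → Tendsto (fun n => lowerPerturb hT hV n t f) atTop (𝓝 (L f)) := by
  have key : ∀ f : Lp ℂ 2 μ, 0 ≤ f → ∃ y,
      Tendsto (fun n => (T.boundedPerturb (truncation₂ μ hV n n)).op t f) atTop (𝓝 y) ∧
      Tendsto (fun n => lowerPerturb hT hV n t f) atTop (𝓝 y) := by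
    intro f hf
    obtain ⟨z, hz⟩ := h f
    have hcau := hz.cauchySeq
    have hle : ∀ n n', n ≤ n' → ‖lowerPerturb hT hV n' t f - lowerPerturb hT hV n t f‖ ≤
        ‖(T.boundedPerturb (truncation₂ μ hV 0 n')).op t f -
          (T.boundedPerturb (truncation₂ μ hV 0 n)).op t f‖ := fun n n' hnn =>
      le_of_tendsto' ((tendsto_lowerPerturb hT hV n' t f).sub
        (tendsto_lowerPerturb hT hV n t f)).norm fun m =>
          norm_boundedPerturb_truncation₂_sub_le hT hV m hnn t hf
    have hP : CauchySeq fun n => lowerPerturb hT hV n t f := by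
      rw [Metric.cauchySeq_iff'] at hcau ⊢
      intro ε hε
      obtain ⟨N, hN⟩ := hcau ε hε
      refine ⟨N, fun n hn => ?_⟩
      have := hN n hn
      rw [dist_eq_norm] at this ⊢
      exact (hle N n hn).trans_lt this
    obtain ⟨y, hy⟩ := cauchySeq_tendsto_of_complete hP
    refine ⟨y, ?_, hy⟩
    rw [Metric.tendsto_atTop]
    intro ε hε
    obtain ⟨N, hN⟩ := Metric.cauchySeq_iff'.1 hcau (ε / 3) (by positivity)
    obtain ⟨N', hN'⟩ := Metric.tendsto_atTop.1 hy (ε / 3) (by positivity)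
    obtain ⟨N₁, hN₁⟩ := Metric.cauchySeq_iff.1 hcau (ε / 3) (by positivity)
    -- A fixed lower cutoff `n` gives three errors: from `(k, k)` to `(k, n)` uniformly in the upper
    -- cutoff, from `(k, n)` to its limit in `k`, and from that limit to `y`.
    set n := max N₁ N' with hn
    obtain ⟨K, hK⟩ := Metric.tendsto_atTop.1 (tendsto_lowerPerturb hT hV n t f) (ε / 3)
      (by positivity)
    refine ⟨max K n, fun k hk => ?_⟩
    have hkn : n ≤ k := (le_max_right _ _).trans hk
    have h1 := norm_boundedPerturb_truncation₂_sub_le hT hV k hkn t hf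
    rw [← dist_eq_norm, ← dist_eq_norm] at h1
    have h2 := hN₁ k ((le_max_left _ _).trans hkn) n (le_max_left _ _)
    have h3 := hK k ((le_max_left _ _).trans hk)
    have h4 := hN' n (le_max_right _ _)
    refine (dist_triangle4 _ _ _ _).trans_lt
      (add_lt_add (add_lt_add (h1.trans_lt h2) h3) h4) |>.trans_eq (by ring)
  obtain ⟨L, hL⟩ := exists_strong_limit
    (A := fun n => (T.boundedPerturb (truncation₂ μ hV n n)).op t) fun f hf =>
      let ⟨y, hy, _⟩ := key f hf; ⟨y, hy⟩
  refine ⟨L, hL, fun f hf => ?_⟩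
  obtain ⟨y, hy, hy'⟩ := key f hf
  rwa [tendsto_nhds_unique (hL f) hy]

end Potential

end Lp

/-! ### Removing the growth factor by Phragmén–Lindelöf -/

section PhragmenLindelof

/-- A bounded holomorphic function on the right half-plane which is `O(e^{ct - γ/t})` on the
positive real axis satisfies `|F(t)| ≤ C e^{-γ/t}` there, with the global bound `C`. -/
theorem norm_le_exp_neg_div {F : ℂ → ℂ} {C γ c : ℝ} (hF : DifferentiableOn ℂ F {z | 0 < z.re})
    (hC : ∀ z : ℂ, 0 < z.re → ‖F z‖ ≤ C) (hγ : 0 < γ) (hc : 0 ≤ c)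
    (h : ∀ x : ℝ, 0 < x → ‖F x‖ ≤ C * (Real.exp (c * x) * Real.exp (-γ / x))) {x : ℝ} (hx : 0 < x) :
    ‖F x‖ ≤ C * Real.exp (-γ / x) := by
  have hC0 : 0 ≤ C := (norm_nonneg _).trans (hC 1 (by simp))
  have hinv : ∀ w : ℂ, 0 < w.re → 0 < (w⁻¹).re := fun w hw => by
    rw [Complex.inv_re]
    exact div_pos hw (Complex.normSq_pos.2 fun h0 => by simp [h0] at hw)
  -- The shift by `ε` keeps `1 / (w + ε)` inside the open half-plane, as `F` need not have boundary
  -- values.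
  have key : ∀ ε : ℝ, 0 < ε → ∀ w : ℂ, 0 ≤ w.re →
      ‖F (w + ε)⁻¹ * Complex.exp (γ * (w + ε))‖ ≤ C * Real.exp (γ * ε) := by
    intro ε hε w hw
    have hre : ∀ w : ℂ, 0 ≤ w.re → 0 < (w + ε).re := fun w hw => by
      rw [Complex.add_re, Complex.ofReal_re]; linarith
    have hb : ∀ w : ℂ, 0 ≤ w.re → ‖F (w + ε)⁻¹ * Complex.exp (γ * (w + ε))‖ ≤
        C * Real.exp (γ * ε) * Real.exp (γ * w.re) := fun w hw => by
      rw [norm_mul, Complex.norm_exp, Complex.re_ofReal_mul, Complex.add_re, Complex.ofReal_re,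
        mul_add, Real.exp_add, mul_assoc, mul_comm (Real.exp (γ * ε))]
      exact mul_le_mul_of_nonneg_right (hC _ (hinv _ (hre w hw))) (by positivity)
    refine PhragmenLindelof.right_half_plane_of_bounded_on_real
      (f := fun w => F (w + ε)⁻¹ * Complex.exp (γ * (w + ε))) ?_ ⟨1, one_lt_two, γ, ?_⟩ ?_ ?_ hw
    · refine DifferentiableOn.diffContOnCl ?_
      rw [Complex.closure_setOfPred_lt_re]
      refine DifferentiableOn.mul ?_ (by fun_prop)
      refine hF.comp (DifferentiableOn.inv (by fun_prop) fun w hw h0 => ?_)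
        fun w hw => hinv _ (hre w hw)
      have := hre w hw
      simp [h0] at this
    · refine Asymptotics.IsBigO.of_bound (C * Real.exp (γ * ε)) ?_
      filter_upwards [mem_inf_of_right (mem_principal_self _)] with w hw
      refine (hb w (le_of_lt hw)).trans ?_
      rw [Real.rpow_one, Real.norm_of_nonneg (Real.exp_pos _).le]
      gcongr
      exact Complex.re_le_norm w
    · refine ⟨C * Real.exp (c / ε), ?_⟩
      rw [eventually_map]
      filter_upwards [eventually_ge_atTop 0] with y hy
      have hyε : 0 < y + ε := by linarith
      have e1 : ((y : ℂ) + ε)⁻¹ = (((y + ε)⁻¹ : ℝ) : ℂ) := by push_cast; rfl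
      have e2 : (γ : ℂ) * (y + ε) = ((γ * (y + ε) : ℝ) : ℂ) := by push_cast; rfl
      rw [norm_mul, e1, e2, Complex.norm_exp, Complex.ofReal_re]
      refine (mul_le_mul_of_nonneg_right (h _ (inv_pos.2 hyε)) (Real.exp_pos _).le).trans ?_
      rw [mul_assoc, mul_assoc, ← Real.exp_add, div_inv_eq_mul, neg_mul, neg_add_cancel,
        Real.exp_zero, mul_one, ← div_eq_mul_inv]
      gcongr
      linarith
    · intro y
      have := hb (y * Complex.I) (by simp)
      simpa using this
  have h1 : ∀ᶠ ε : ℝ in 𝓝[>] 0, ‖F x‖ * Real.exp (γ / x) ≤ C * Real.exp (γ * ε) := by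
    filter_upwards [Ioo_mem_nhdsGT (inv_pos.2 hx)] with ε hε
    have := key ε hε.1 (((x⁻¹ - ε : ℝ)) : ℂ) (by rw [Complex.ofReal_re]; linarith [hε.2])
    have e1 : (((x⁻¹ - ε : ℝ)) : ℂ) + ε = ((x⁻¹ : ℝ) : ℂ) := by push_cast; ring
    rw [e1, norm_mul, ← Complex.ofReal_mul, Complex.norm_exp, Complex.ofReal_re,
      ← Complex.ofReal_inv, inv_inv, ← div_eq_mul_inv] at this
    exact this
  have h2 : Tendsto (fun ε : ℝ => C * Real.exp (γ * ε)) (𝓝[>] 0) (𝓝 C) := by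
    refine tendsto_nhdsWithin_of_tendsto_nhds ?_
    have : Continuous fun ε : ℝ => C * Real.exp (γ * ε) := by fun_prop
    exact this.tendsto' _ _ (by simp)
  have h3 := ge_of_tendsto h2 h1
  rw [neg_div, Real.exp_neg, ← div_eq_mul_inv, le_div_iff₀ (Real.exp_pos _)]
  exact h3

end PhragmenLindelof

/-! ### Complex powers in a C⋆-algebra -/

section ComplexPower

/-- Passing to `l.re` avoids the branch cut, while nothing changes on the real spectrum of a
self-adjoint element. -/
theorem continuousOn_re_cpow {z : ℂ} (hz : 0 < z.re) (s : Set ℂ) :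
    ContinuousOn (fun l : ℂ => (l.re : ℂ) ^ z) s := by
  refine Continuous.continuousOn (continuous_iff_continuousAt.2 fun l => ?_)
  exact (Complex.continuousAt_ofReal_cpow l.re z (.inl hz)).comp (f := fun l : ℂ => (l.re, z))
    (by fun_prop)

theorem norm_ofReal_cpow_sub_exp_le {z : ℂ} (hz : 0 < z.re) {r δ : ℝ} (hr : 0 ≤ r) (hδ : 0 < δ) :
    ‖(r : ℂ) ^ z - Complex.exp (z * (Real.log (max r δ) : ℝ))‖ ≤ 2 * δ ^ z.re := by
  have hexp : ∀ s : ℝ, 0 < s → Complex.exp (z * (Real.log s : ℝ)) = (s : ℂ) ^ z := fun s hs => by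
    rw [Complex.cpow_def_of_ne_zero (by exact_mod_cast hs.ne'), Complex.ofReal_log hs.le, mul_comm]
  rw [hexp _ (lt_max_of_lt_right hδ)]
  rcases le_total δ r with h | h
  · rw [max_eq_left h, sub_self, norm_zero]
    positivity
  · rw [max_eq_right h]
    refine (norm_sub_le _ _).trans ?_
    rw [Complex.norm_cpow_eq_rpow_re_of_nonneg hr hz.ne',
      Complex.norm_cpow_eq_rpow_re_of_pos hδ, two_mul]
    gcongr

variable {A : Type*} [CStarAlgebra A]

/-- The power `a ^ z` of a nonnegative element, for `Re z > 0`. -/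
def complexPower (a : A) (z : ℂ) : A := cfc (fun l : ℂ => (l.re : ℂ) ^ z) a

theorem norm_complexPower_le {a : A} (h1 : ∀ l ∈ spectrum ℂ a, 0 ≤ l.re ∧ l.re ≤ 1) {z : ℂ}
    (hz : 0 < z.re) : ‖complexPower a z‖ ≤ 1 := by
  refine norm_cfc_le zero_le_one fun l hl => ?_
  rw [Complex.norm_cpow_eq_rpow_re_of_nonneg (h1 l hl).1 hz.ne']
  exact Real.rpow_le_one (h1 l hl).1 (h1 l hl).2 hz.le

/-- The logarithm is unbounded when `0` lies in the spectrum. Replacing `log r` by `log (max r δ)`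
gives entire functions `exp (z L)`, which converge locally uniformly for `Re z > 0` as `δ → 0`. -/
theorem differentiableOn_complexPower {a : A} (ha : IsStarNormal a)
    (h1 : ∀ l ∈ spectrum ℂ a, 0 ≤ l.re) :
    DifferentiableOn ℂ (complexPower a) {z | 0 < z.re} := by
  let δ : ℕ → ℝ := fun n => 1 / ((n : ℝ) + 1)
  have hδ : ∀ n, 0 < δ n := fun n => by positivity
  have hδ1 : ∀ n, δ n ≤ 1 := fun n => by
    rw [div_le_one (by positivity)]; linarith [(n.cast_nonneg : (0 : ℝ) ≤ n)]
  have hlog : ∀ n, Continuous fun l : ℂ => ((Real.log (max l.re (δ n)) : ℝ) : ℂ) := fun n =>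
    Complex.continuous_ofReal.comp ((by fun_prop : Continuous fun l : ℂ => max l.re (δ n)).log
      fun l => (lt_max_of_lt_right (hδ n)).ne')
  let L : ℕ → A := fun n => cfc (fun l : ℂ => ((Real.log (max l.re (δ n)) : ℝ) : ℂ)) a
  have hL : ∀ n z, NormedSpace.exp (z • L n) =
      cfc (fun l : ℂ => Complex.exp (z * (Real.log (max l.re (δ n)) : ℝ))) a := fun n z => by
    have hc : ContinuousOn (fun l : ℂ => z * ((Real.log (max l.re (δ n)) : ℝ) : ℂ))
        (spectrum ℂ a) := ((hlog n).const_mul z).continuousOn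
    rw [cfc_comp' Complex.exp (fun l : ℂ => z * (Real.log (max l.re (δ n)) : ℝ)) a
        Complex.continuous_exp.continuousOn hc ha,
      CFC.complex_exp_eq_normedSpace_exp (cfc_predicate _ a), cfc_const_mul z _ a
        (hlog n).continuousOn]
  have hdist : ∀ n z, 0 < z.re → dist (complexPower a z) (NormedSpace.exp (z • L n)) ≤
      2 * δ n ^ z.re := fun n z hz => by
    have hc : Continuous fun l : ℂ => Complex.exp (z * (Real.log (max l.re (δ n)) : ℝ)) :=
      Complex.continuous_exp.comp ((hlog n).const_mul z)
    rw [dist_eq_norm, hL, complexPower, ← cfc_sub _ _ a (continuousOn_re_cpow hz _)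
      hc.continuousOn]
    exact norm_cfc_le (by have := hδ n; positivity) fun l hl =>
      norm_ofReal_cpow_sub_exp_le hz (h1 l hl) (hδ n)
  refine TendstoLocallyUniformlyOn.differentiableOn (φ := atTop)
    (F := fun n z => NormedSpace.exp (z • L n)) ?_ (.of_forall fun n z _ =>
      (hasDerivAt_exp_smul_const (L n) z).differentiableAt.differentiableWithinAt)
      (isOpen_lt continuous_const Complex.continuous_re)
  rw [Metric.tendstoLocallyUniformlyOn_iff]
  intro ε hε z hz
  have hz' : z.re / 2 < z.re := half_lt_self hz
  have hlim : Tendsto (fun n => 2 * δ n ^ (z.re / 2)) atTop (𝓝 0) := by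
    have h0 : Tendsto δ atTop (𝓝 0) := tendsto_one_div_add_atTop_nhds_zero_nat
    have := (h0.rpow_const (p := z.re / 2) (.inr (half_pos hz).le)).const_mul 2
    rwa [Real.zero_rpow (half_pos hz).ne', mul_zero] at this
  -- Here `δ ≤ 1` gives `δ ^ w.re ≤ δ ^ (z.re / 2)`, a bound uniform in `w`.
  refine ⟨{w | z.re / 2 < w.re}, mem_nhdsWithin_of_mem_nhds
    ((isOpen_lt continuous_const Complex.continuous_re).mem_nhds hz'), ?_⟩
  filter_upwards [hlim.eventually_lt_const hε] with n hn w hw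
  refine (hdist n w ((half_pos hz).trans hw)).trans_lt (lt_of_le_of_lt ?_ hn)
  gcongr 2 * ?_
  exact Real.rpow_le_rpow_of_exponent_ge (hδ n) (hδ1 n) (le_of_lt hw)

theorem complexPower_pow {a : A} (ha : _root_.IsSelfAdjoint a)
    (h1 : ∀ l ∈ spectrum ℂ a, 0 ≤ l.re) {j n : ℕ} (hj : 0 < j) (hn : 0 < n) :
    complexPower (a ^ n) (((j / n : ℝ)) : ℂ) = a ^ j := by
  have hz : 0 < (((j / n : ℝ)) : ℂ).re := by
    rw [Complex.ofReal_re]; positivity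
  have hna : IsStarNormal a := ha.isStarNormal
  rw [complexPower,
    ← cfc_comp_pow (fun l : ℂ => (l.re : ℂ) ^ (((j / n : ℝ)) : ℂ)) n a (continuousOn_re_cpow hz _) hna,
    ← cfc_pow_id (R := ℂ) a j hna]
  refine cfc_congr fun l hl => ?_
  have hl0 := h1 l hl
  have hlr : l = (l.re : ℂ) := ha.mem_spectrum_eq_re hl
  rw [hlr, ← Complex.ofReal_pow, Complex.ofReal_re, ← Complex.ofReal_cpow (by positivity),
    ← Real.rpow_natCast, ← Real.rpow_mul hl0, mul_div_cancel₀ _ (by positivity),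
    Real.rpow_natCast, Complex.ofReal_pow]

end ComplexPower

/-! ### Contractive self-adjoint semigroups -/

section Semigroup

variable {H : Type*} [NormedAddCommGroup H] [InnerProductSpace ℂ H] [CompleteSpace H]

omit [CompleteSpace H] in
theorem semigroup_nsmul {P : ℝ≥0 → H →L[ℂ] H} (hadd : ∀ s t, P (s + t) = P s * P t) (t : ℝ≥0)
    {n : ℕ} (hn : 0 < n) : P (n * t) = P t ^ n := by
  induction n, hn using Nat.le_induction with
  | base => simp
  | succ n _ ih => rw [Nat.cast_succ, add_mul, one_mul, hadd, ih, pow_succ]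

/-- Nonnegativity comes from `P(t) = P(t/2)⋆ P(t/2)`, the upper bound from contractivity. -/
theorem spectrum_semigroup {P : ℝ≥0 → H →L[ℂ] H} (hadd : ∀ s t, P (s + t) = P s * P t)
    (hsa : ∀ t, _root_.IsSelfAdjoint (P t)) (hP : ∀ t, ‖P t‖ ≤ 1) (t : ℝ≥0) :
    ∀ l ∈ spectrum ℂ (P t), 0 ≤ l.re ∧ l.re ≤ 1 := by
  intro l hl
  have h0 : 0 ≤ P t := by
    have h := star_mul_self_nonneg (P (t / 2))
    rwa [(hsa _).star_eq, ← hadd, add_halves] at h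
  refine ⟨(Complex.nonneg_iff.1 (spectrum_nonneg_of_nonneg h0 hl)).1, ?_⟩
  refine (Complex.re_le_norm l).trans ((spectrum.norm_le_norm_mul_of_mem hl).trans ?_)
  exact mul_le_one₀ (hP t) (norm_nonneg _) ContinuousLinearMap.norm_id_le

/-- For a contractive self-adjoint semigroup, growth factors `e^{ct}` in a Davies–Gaffney
estimate can be removed. -/
theorem norm_inner_le_of_exp {P : ℝ≥0 → H →L[ℂ] H} (hadd : ∀ s t, P (s + t) = P s * P t)
    (hsa : ∀ t, _root_.IsSelfAdjoint (P t)) (hP : ∀ t, ‖P t‖ ≤ 1) {γ c : ℝ} (hγ : 0 < γ)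
    (hc : 0 ≤ c) {f g : H} (h : ∀ t : ℝ≥0, 0 < t →
      ‖inner ℂ g (P t f)‖ ≤ ‖f‖ * ‖g‖ * (Real.exp (c * t) * Real.exp (-γ / t)))
    {t : ℝ≥0} (ht : 0 < t) : ‖inner ℂ g (P t f)‖ ≤ ‖f‖ * ‖g‖ * Real.exp (-γ / t) := by
  have ht' : (0 : ℝ) < t := ht
  have hspec := spectrum_semigroup hadd hsa hP
  set F : ℂ → ℂ := fun z => inner ℂ g (complexPower (P t) z f) with hF
  have hd : DifferentiableOn ℂ F {z | 0 < z.re} := by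
    have h1 := differentiableOn_complexPower (hsa t).isStarNormal fun l hl => (hspec t l hl).1
    exact (innerSL ℂ g ∘L ContinuousLinearMap.apply ℂ H f).differentiable.comp_differentiableOn h1
  have hb : ∀ z : ℂ, 0 < z.re → ‖F z‖ ≤ ‖f‖ * ‖g‖ := fun z hz => by
    refine (norm_inner_le_norm _ _).trans ?_
    rw [mul_comm]
    refine mul_le_mul_of_nonneg_right ?_ (norm_nonneg _)
    simpa using ContinuousLinearMap.le_of_opNorm_le _ (norm_complexPower_le (hspec t) hz) f
  -- The power `P(t)^x` is identified with `P(xt)` at rational `x` only; continuity of `P` in time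
  -- is not assumed, and real `x` are reached through continuity of `F`.
  have hrat : ∀ j n : ℕ, 0 < j → 0 < n →
      F ((j / n : ℝ) : ℂ) = inner ℂ g (P (j * (t / n)) f) := fun j n hj hn => by
    have h1 : P t = P (t / n) ^ n := by
      rw [← semigroup_nsmul hadd _ hn, mul_div_cancel₀ _ (by positivity)]
    simp only [hF]
    rw [h1, complexPower_pow (hsa _) (fun l hl => (hspec _ l hl).1) hj hn,
      semigroup_nsmul hadd _ hj]
  have hreal : ∀ x : ℝ, 0 < x →
      ‖F x‖ ≤ ‖f‖ * ‖g‖ * (Real.exp ((c * t) * x) * Real.exp (-(γ / t) / x)) := by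
    have hF' : ContinuousOn (fun x : ℝ => ‖F x‖) (Set.Ioi 0) :=
      (hd.continuousOn.comp Complex.continuous_ofReal.continuousOn fun x hx => by
        simpa using hx).norm
    have hR : ContinuousOn (fun x : ℝ => ‖f‖ * ‖g‖ *
        (Real.exp ((c * t) * x) * Real.exp (-(γ / t) / x))) (Set.Ioi 0) := by
      have : ContinuousOn (fun x : ℝ => -(γ / t) / x) (Set.Ioi 0) :=
        continuousOn_const.div continuousOn_id fun x hx => ne_of_gt hx
      fun_prop
    intro x hx
    by_contra! hlt
    have hev := ((hR.continuousAt (Ioi_mem_nhds hx)).eventually_lt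
      (hF'.continuousAt (Ioi_mem_nhds hx)) hlt).and (Ioi_mem_nhds hx)
    obtain ⟨U, hU, hUo, hxU⟩ := eventually_nhds_iff.1 hev
    obtain ⟨q, hq⟩ := (Rat.denseRange_cast (𝕜 := ℝ)).exists_mem_open hUo ⟨x, hxU⟩
    obtain ⟨hq1, hq2⟩ := hU _ hq
    have hq0 : 0 < q := by exact_mod_cast (show (0 : ℝ) < q from hq2)
    have hj : 0 < q.num.toNat := by
      have := Rat.num_pos.2 hq0
      omega
    have hqe : (q : ℝ) = (q.num.toNat : ℝ) / (q.den : ℝ) := by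
      have h1 : ((q.num.toNat : ℤ) : ℝ) = (q.num : ℝ) := by
        rw [Int.toNat_of_nonneg (Rat.num_pos.2 hq0).le]
      rw [Rat.cast_def, ← h1, Int.cast_natCast]
    refine absurd hq1 (not_lt.2 ?_)
    rw [hqe, hrat _ _ hj q.den_pos]
    refine (h _ (by have := q.den_pos; positivity)).trans_eq ?_
    have hden : (0 : ℝ) < q.den := by exact_mod_cast q.den_pos
    have hnum : (0 : ℝ) < q.num.toNat := by exact_mod_cast hj
    push_cast
    congr 3
    · ring
    · field_simp
  -- In the variable `x`, time is `t x`; the constants become `γ / t` and `c t`, and the point of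
  -- interest is `x = 1`.
  have h1 := norm_le_exp_neg_div hd hb (div_pos hγ ht') (mul_nonneg hc ht'.le) hreal one_pos
  have h2 := hrat 1 1 one_pos one_pos
  simp only [Nat.cast_one, div_one, one_mul, Complex.ofReal_one] at h1 h2
  rwa [h2, ← neg_div] at h1

end Semigroup

end C0Semigroup

end

/-! ### The main theorem -/

theorem mainTheorem8 {Ω : Type*} [MeasurableSpace Ω] {μ : Measure Ω}
    (T : C0Semigroup (Lp ℂ 2 μ)) (hT_pos : T.IsPositive) (hT_sa : T.IsSelfAdjoint)
    (γ : ℝ) (hγ : 0 < γ) (f g : Lp ℂ 2 μ) (hf : 0 ≤ f) (hg : 0 ≤ g)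
    (hT_DG : ∀ t : ℝ≥0, 0 < t →
      inner ℂ g (T.op t f) ≤ ((Real.exp (-γ / t) * ‖f‖ * ‖g‖ : ℝ) : ℂ))
    (V : Ω → ℝ) (hV : Measurable V) (hV_adm : T.IsAdmissible hV)
    (hV_contr : ∀ t : ℝ≥0, ‖T.perturb hV t‖ ≤ 1) :
    (∀ t : ℝ≥0, T.IsPerturbLimit hV t (T.perturb hV t)) ∧
    ∀ t : ℝ≥0, 0 < t →
      inner ℂ g (T.perturb hV t f) ≤ ((Real.exp (-γ / t) * ‖f‖ * ‖g‖ : ℝ) : ℂ) := by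
  obtain ⟨S, hS⟩ := hV_adm.2
  have hconv : ∀ t f, ∃ y, Tendsto
      (fun n => (T.boundedPerturb (C0Semigroup.truncation₂ μ hV 0 n)).op t f) atTop (𝓝 y) :=
    fun t f => ⟨S.op t f, (hS t f).congr fun n => by rw [C0Semigroup.truncation_min_zero_eq]⟩
  choose L hL hL' using fun t => C0Semigroup.exists_isPerturbLimit hT_pos hV t (hconv t)
  have hlim : ∀ t, T.IsPerturbLimit hV t (T.perturb hV t) := fun t => by
    have hex : ∃ L, T.IsPerturbLimit hV t L := ⟨L t, hL t⟩
    rw [C0Semigroup.perturb, dif_pos hex]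
    exact hex.choose_spec
  have hLeq : ∀ t f, L t f = T.perturb hV t f := fun t f =>
    tendsto_nhds_unique (hL t f) (hlim t f)
  refine ⟨hlim, fun t ht => ?_⟩
  -- Domination by `T_V(t)` bounds norms on nonnegative functions only; self-adjointness and the
  -- semigroup law extend this to all of `L_2`.
  have hnorm : ∀ n t, ‖C0Semigroup.lowerPerturb hT_pos hV n t‖ ≤ 1 := fun n t =>
    C0Semigroup.norm_le_one_of_nonneg (C0Semigroup.lowerPerturb_add hT_pos hV n)
      (C0Semigroup.lowerPerturb_isSelfAdjoint hT_pos hT_sa hV n) (fun t f hf => by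
        refine (C0Semigroup.norm_le_norm_of_le (C0Semigroup.lowerPerturb_nonneg hT_pos hV n t hf)
          (C0Semigroup.lowerPerturb_le hT_pos hV (hlim t) n hf)).trans ?_
        simpa using (T.perturb hV t).le_of_opNorm_le (hV_contr t) f) t
  have hinner : ∀ n t, 0 ≤ inner ℂ g (C0Semigroup.lowerPerturb hT_pos hV n t f) := fun n t =>
    C0Semigroup.inner_nonneg_Lp hg (C0Semigroup.lowerPerturb_nonneg hT_pos hV n t hf)
  have hexp : ∀ (n : ℕ) (t : ℝ≥0), 0 < t →
      ‖inner ℂ g (C0Semigroup.lowerPerturb hT_pos hV n t f)‖ ≤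
        ‖f‖ * ‖g‖ * (Real.exp (n * t) * Real.exp (-γ / t)) := by
    intro n t ht
    have h1 := C0Semigroup.inner_nonneg_Lp hg
      (sub_nonneg.2 (C0Semigroup.lowerPerturb_le_exp_smul hT_pos hV n t hf))
    rw [inner_sub_right, sub_nonneg, inner_smul_right] at h1
    have h2 := h1.trans (mul_le_mul_of_nonneg_left (hT_DG t ht)
      (Complex.zero_le_real.2 (Real.exp_pos _).le))
    rw [Complex.eq_coe_norm_of_nonneg (hinner n t), ← Complex.ofReal_mul,
      Complex.real_le_real] at h2
    exact h2.trans_eq (by ring)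
  have hfin : ∀ n, inner ℂ g (C0Semigroup.lowerPerturb hT_pos hV n t f) ≤
      ((Real.exp (-γ / t) * ‖f‖ * ‖g‖ : ℝ) : ℂ) := fun n => by
    rw [Complex.eq_coe_norm_of_nonneg (hinner n t), Complex.real_le_real]
    exact (C0Semigroup.norm_inner_le_of_exp (C0Semigroup.lowerPerturb_add hT_pos hV n)
      (C0Semigroup.lowerPerturb_isSelfAdjoint hT_pos hT_sa hV n) (hnorm n) hγ n.cast_nonneg
      (hexp n) ht).trans_eq (by ring)
  -- The bound no longer depends on `n`, so it survives the limit `T_{V∨(-n)}(t) f → T_V(t) f`.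
  have hL'' := hL' t f hf
  rw [hLeq] at hL''
  exact le_of_tendsto' ((tendsto_const_nhds (x := g)).inner (𝕜 := ℂ) hL'') hfin
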